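/- Let $\mathcal H$ be an infinite-dimensional complex Hilbert space, $B(\mathcal H)^+$ the set of positive bounded operators on $\mathcal H$, and $\mathbb P$ the set of positive invertible operators in $B(\mathcal H)$, ordered by the Loewner order; write $A_k\searrow A$ (resp. $A_k\nearrow A$) if $(A_k)_{k\in\mathbb N}$ is decreasing (resp. increasing) and $A_k\to A$ in the strong operator topology (SOT). A map $\sigma:B(\mathcal H)^+\times B(\mathcal H)^+\to B(\mathcal H)^+$ is an operator mean (Kubo–Ando mean) if (i) $A\le C$, $B\le D$ imply $A\sigma B\le C\sigma D$; (ii) $C(A\sigma B)C\le (CAC)\sigma(CBC)$ for every $C\in B(\mathcal H)^+$; (iii) $A_k\searrow A$, $B_k\searrow B$ imply $A_k\sigma B_k\searrow A\sigma B$; (iv) $I\sigma I=I$. Such a mean maps $\mathbb P\times\mathbb P$ into $\mathbb P$. A map $M:\mathbb P^n\to\mathbb P$ is an $n$-variable operator mean if * (I) $A_j\le B_j$ for $1\le j\le n$ implies $M(A_1,\dots,A_n)\le M(B_1,\dots,B_n)$; * (II) $S^*M(A_1,\dots,A_n)S=M(S^*A_1S,\dots,S^*A_nS)$ for every invertible $S\in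 B(\mathcal H)$; * (III) if $A_j,A_{jk}\in\mathbb P$ and either $A_{jk}\searrow A_j$ as $k\to\infty$ for every $j$, or $A_{jk}\nearrow A_j$ as $k\to\infty$ for every $j$, then $M(A_{1k},\dots,A_{nk})\to M(A_1,\dots,A_n)$ in SOT; * (IV) $M(I,\dots,I)=I$. Theorem 2.1. Let $M$ be an $n$-variable operator mean and $\sigma$ an operator mean other than the left trivial mean $(A,B)\mapsto A$. 1. For every $A_1,\dots,A_n\in\mathbb P$ there exists a unique $X\in\mathbb P$ with $X=M(X\sigma A_1,\dots,X\sigma A_n)$. 2. Write $M_\sigma(A_1,\dots,A_n)$ for this unique solution. Then $M_\sigma:\mathbb P^n\to\mathbb P$ is again an $n$-variable operator mean, i.e. it satisfies (I)–(IV). 3. Let $A_1,\dots,A_n,Y\in\mathbb P$. If $Y\le M(Y\sigma A_1,\dots,Y\sigma A_n)$, then $Y\le M_\sigma(A_1,\dots,A_n)$. If $Y\ge M(Y\sigma A_1,\dots,Y\sigma A_n)$, then $Y\ge M_\sigma(A_1,\dots,A_n)$. -/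

import Mathlib

open Filter Topology

/-- `B(H)⁺`: the positive bounded operators on `H`, with the Loewner order. -/
abbrev PosOp (H : Type*) [NormedAddCommGroup H] [InnerProductSpace ℂ H] [CompleteSpace H] :=
  {A : H →L[ℂ] H // 0 ≤ A}

/-- `ℙ(H)`: the positive invertible bounded operators on `H`, with the Loewner order. -/
abbrev PosInv (H : Type*) [NormedAddCommGroup H] [InnerProductSpace ℂ H] [CompleteSpace H] :=
  {A : H →L[ℂ] H // 0 ≤ A ∧ IsUnit A}

/-- `A_k → A` in the strong operator topology. -/
def SOTTendsto {H : Type*} [NormedAddCommGroup H] [InnerProductSpace ℂ H]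
    (T : ℕ → H →L[ℂ] H) (L : H →L[ℂ] H) : Prop :=
  ∀ x : H, Tendsto (fun k => T k x) atTop (𝓝 (L x))

/-- The identity operator as an element of `B(H)⁺`. -/
def PosOp.id (H : Type*) [NormedAddCommGroup H] [InnerProductSpace ℂ H] [CompleteSpace H] :
    PosOp H :=
  ⟨1, zero_le_one⟩

/-- `C A C` for `C, A ∈ B(H)⁺`. -/
def PosOp.sandwich {H : Type*} [NormedAddCommGroup H] [InnerProductSpace ℂ H] [CompleteSpace H]
    (C A : PosOp H) : PosOp H :=
  ⟨C.1 * A.1 * C.1, by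
    have hC : star C.1 = C.1 := IsSelfAdjoint.of_nonneg C.2
    have := star_left_conjugate_nonneg A.2 C.1
    rwa [hC] at this⟩

/-- The inclusion of `ℙ(H)` in `B(H)⁺`. -/
def PosInv.toPosOp {H : Type*} [NormedAddCommGroup H] [InnerProductSpace ℂ H] [CompleteSpace H]
    (A : PosInv H) : PosOp H :=
  ⟨A.1, A.2.1⟩

/-- The identity operator as an element of `ℙ(H)`. -/
def PosInv.id (H : Type*) [NormedAddCommGroup H] [InnerProductSpace ℂ H] [CompleteSpace H] :
    PosInv H :=
  ⟨1, zero_le_one, isUnit_one⟩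

/-- `S* A S` for `A ∈ ℙ(H)` and `S` an invertible bounded operator. -/
noncomputable def PosInv.congr {H : Type*} [NormedAddCommGroup H] [InnerProductSpace ℂ H] [CompleteSpace H]
    (S : (H →L[ℂ] H)ˣ) (A : PosInv H) : PosInv H :=
  ⟨star (S : H →L[ℂ] H) * A.1 * (S : H →L[ℂ] H),
    star_left_conjugate_nonneg A.2.1 _, (S.isUnit.star.mul A.2.2).mul S.isUnit⟩

/-- A map `σ : B(H)⁺ × B(H)⁺ → B(H)⁺` is a (two-variable, Kubo–Ando) operator mean. -/
structure IsOperatorMean {H : Type*} [NormedAddCommGroup H] [InnerProductSpace ℂ H]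
    [CompleteSpace H] (σ : PosOp H → PosOp H → PosOp H) : Prop where
  /-- monotonicity -/
  monotone : ∀ A B C D : PosOp H, A ≤ C → B ≤ D → σ A B ≤ σ C D
  /-- transformer inequality -/
  transformer : ∀ A B C : PosOp H,
    PosOp.sandwich C (σ A B) ≤ σ (PosOp.sandwich C A) (PosOp.sandwich C B)
  /-- downward continuity -/
  downward : ∀ (A B : ℕ → PosOp H) (A' B' : PosOp H),
    Antitone A → SOTTendsto (fun k => (A k).1) A'.1 →
    Antitone B → SOTTendsto (fun k => (B k).1) B'.1 →
    Antitone (fun k => σ (A k) (B k)) ∧ SOTTendsto (fun k => (σ (A k) (B k)).1) (σ A' B').1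
  /-- normalized condition -/
  normalized : σ (PosOp.id H) (PosOp.id H) = PosOp.id H

/-- A map `M : ℙ(H)ⁿ → ℙ(H)` is an `n`-variable operator mean. -/
structure IsMultivariateMean {H : Type*} [NormedAddCommGroup H] [InnerProductSpace ℂ H]
    [CompleteSpace H] {n : ℕ} (M : (Fin n → PosInv H) → PosInv H) : Prop where
  /-- monotonicity -/
  monotone : ∀ A B : Fin n → PosInv H, (∀ j, A j ≤ B j) → M A ≤ M B
  /-- congruence invariance -/
  congruence : ∀ (A : Fin n → PosInv H) (S : (H →L[ℂ] H)ˣ),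
    PosInv.congr S (M A) = M (fun j => PosInv.congr S (A j))
  /-- monotone continuity: `A j k` is the `k`-th term of the `j`-th sequence -/
  continuity : ∀ (A : Fin n → ℕ → PosInv H) (L : Fin n → PosInv H),
    ((∀ j, Antitone (A j)) ∨ (∀ j, Monotone (A j))) →
    (∀ j, SOTTendsto (fun k => (A j k).1) (L j).1) →
    SOTTendsto (fun k => (M (fun j => A j k)).1) (M L).1
  /-- normalized condition -/
  normalized : M (fun _ => PosInv.id H) = PosInv.id H

/-- An operator mean of two positive invertible operators is invertible. -/
theorem IsOperatorMean.isUnit_apply {H : Type*} [NormedAddCommGroup H] [InnerProductSpace ℂ H]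
    [CompleteSpace H] {σ : PosOp H → PosOp H → PosOp H} (hσ : IsOperatorMean σ)
    (A B : PosInv H) : IsUnit (σ A.toPosOp B.toPosOp).1 := by
  have key : ∀ T : PosInv H, ∃ r : ℝ, 0 < r ∧ algebraMap ℝ (H →L[ℂ] H) r ≤ T.1 := by
    intro T
    have hT : IsStrictlyPositive T.1 := IsStrictlyPositive.iff_of_unital.2 T.2
    rcases subsingleton_or_nontrivial (H →L[ℂ] H) with h | h
    · exact ⟨1, one_pos, (Subsingleton.elim _ _).le⟩
    · exact (CFC.exists_pos_algebraMap_le_iff hT.isSelfAdjoint).2 fun x hx => hT.spectrum_pos hx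
  obtain ⟨r, hr, hrA⟩ := key A
  obtain ⟨s, hs, hsB⟩ := key B
  set t : ℝ := min r s with ht
  have htpos : 0 < t := lt_min hr hs
  have htA : algebraMap ℝ (H →L[ℂ] H) t ≤ A.1 :=
    (algebraMap_mono _ (min_le_left r s)).trans hrA
  have htB : algebraMap ℝ (H →L[ℂ] H) t ≤ B.1 :=
    (algebraMap_mono _ (min_le_right r s)).trans hsB
  let C : PosOp H := ⟨algebraMap ℝ (H →L[ℂ] H) (√t), algebraMap_nonneg _ (Real.sqrt_nonneg t)⟩
  have hCC : (PosOp.sandwich C (PosOp.id H)).1 = algebraMap ℝ (H →L[ℂ] H) t := by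
    change algebraMap ℝ (H →L[ℂ] H) (√t) * 1 * algebraMap ℝ (H →L[ℂ] H) (√t) = _
    rw [mul_one, ← map_mul, Real.mul_self_sqrt htpos.le]
  have h1 := hσ.transformer (PosOp.id H) (PosOp.id H) C
  rw [hσ.normalized] at h1
  have h2 : σ (PosOp.sandwich C (PosOp.id H)) (PosOp.sandwich C (PosOp.id H)) ≤
      σ A.toPosOp B.toPosOp := by
    apply hσ.monotone
    · change (PosOp.sandwich C (PosOp.id H)).1 ≤ A.1
      rw [hCC]; exact htA
    · change (PosOp.sandwich C (PosOp.id H)).1 ≤ B.1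
      rw [hCC]; exact htB
  have h3 : algebraMap ℝ (H →L[ℂ] H) t ≤ (σ A.toPosOp B.toPosOp).1 := by
    rw [← hCC]; exact h1.trans h2
  exact CStarAlgebra.isUnit_of_le _ h3
    (IsStrictlyPositive.iff_of_unital.2 ⟨algebraMap_nonneg _ htpos.le,
      htpos.ne'.isUnit.map (algebraMap ℝ (H →L[ℂ] H))⟩)

/-- The restriction of an operator mean to a map `ℙ(H) × ℙ(H) → ℙ(H)`. -/
noncomputable def IsOperatorMean.onPosInv {H : Type*} [NormedAddCommGroup H] [InnerProductSpace ℂ H]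
    [CompleteSpace H] {σ : PosOp H → PosOp H → PosOp H} (hσ : IsOperatorMean σ)
    (A B : PosInv H) : PosInv H :=
  ⟨(σ A.toPosOp B.toPosOp).1, (σ A.toPosOp B.toPosOp).2, hσ.isUnit_apply A B⟩

/-! ### Projections and commutation -/

section Operators

variable {H : Type*} [NormedAddCommGroup H] [InnerProductSpace ℂ H] [CompleteSpace H]

/-! Fix the `A j` and put F(X) = M(X σ A₁, …, X σ Aₙ), a monotone self-map of ℙ. If F(Y) ≤ Y, the
iterates of F at Y decrease. They stay above a small scalar r, because r ≤ F(r) once r lies below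
every A j, so they converge strongly to an invertible fixed point, the largest one below Y
(`exists_fixedPoint_le`). Starting at a large scalar gives existence, and a fixed point above any
prescribed Y with Y ≤ F(Y) (`exists_fixedPoint_ge`).

Uniqueness is a contraction argument (`fixedPoint_le_fixedPoint`). For fixed points X, Y let l be
the least number ≥ 1 with X ≤ lY. If l > 1, homogeneity gives X ≤ l M(Y σ l⁻¹A₁, …, Y σ l⁻¹Aₙ), and
shrinking the second argument of σ by l⁻¹ < 1 gains a factor ρ < 1. Hence X ≤ lρY, against the
choice of l. With uniqueness, axioms (I)–(IV) for the solution map and the comparison statements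
follow from the corresponding properties of F.

The factor ρ requires the structure of σ. One has 1 σ t = f(t) for a scalar function f (`repFun`),
then 1 σ B = f(B) (`opMean_one_eq_cfc`), and by congruence A σ B = A^{1/2} f(A^{-1/2} B A^{-1/2})
A^{1/2} (`opMean_eq_conjugate_cfc`). On a compact interval in (0, ∞) the ratio f(lx)/f(x) attains
its maximum, which is below 1 when f is strictly increasing. Monotonicity of σ on noncommuting pairs
shows that an f taking the same value twice is constant on (0, ∞) (`repFun_eq_of_eq`), and f = 1
characterizes the left trivial mean. This is where dimension at least two is needed.

The formula also supplies strong continuity along increasing sequences and congruence by arbitrary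
invertible operators, neither of which is among the axioms for σ. -/

theorem IsStarProjection.commute_of_conjugate_le {P X : H →L[ℂ] H} (hP : IsStarProjection P)
    (hX : IsSelfAdjoint X) (h : P * X * P ≤ X) : Commute P X := by
  -- The difference E = X - PXP is positive and PEP = 0; writing E = R*R gives RP = 0, hence EP = 0
  -- and XP = PXP.
  have hPP : P * P = P := hP.isIdempotentElem
  have hPs : star P = P := hP.isSelfAdjoint
  obtain ⟨R, hR⟩ := CStarAlgebra.nonneg_iff_eq_star_mul_self.1 (sub_nonneg.2 h)
  have h0 : P * (X - P * X * P) * P = 0 := by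
    simp only [mul_sub, sub_mul, ← mul_assoc, hPP]
    simp only [mul_assoc, hPP, sub_self]
  have h1 : R * P = 0 := by
    rw [← CStarRing.star_mul_self_eq_zero_iff, star_mul, hPs, ← h0, hR]
    simp only [mul_assoc]
  have h2 : (X - P * X * P) * P = 0 := by rw [hR, mul_assoc, h1, mul_zero]
  have h3 : X * P = P * X * P := by
    rw [sub_mul, mul_assoc (P * X), hPP] at h2
    exact sub_eq_zero.1 h2
  have h4 : P * X = P * X * P := by
    have := congrArg star h3
    simpa only [star_mul, hPs, hX.star_eq, mul_assoc] using this
  exact h4.trans h3.symm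

theorem commute_starProjection_ker {N G : H →L[ℂ] H} (hG : IsSelfAdjoint G) (h : Commute G N) :
    Commute G (LinearMap.ker N.toLinearMap).starProjection := by
  set P := (LinearMap.ker N.toLinearMap).starProjection with hPdef
  have hP : IsStarProjection P := isStarProjection_starProjection
  have hPs : star P = P := hP.isSelfAdjoint
  have h3 : G * P = P * G * P := by
    ext x
    have hx : G (P x) ∈ LinearMap.ker N.toLinearMap := by
      have h1 : N (P x) = 0 := Submodule.starProjection_apply_mem (LinearMap.ker N.toLinearMap) x
      have h2 : N (G (P x)) = G (N (P x)) := (congrArg (fun T : H →L[ℂ] H => T (P x)) h.eq).symm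
      change N (G (P x)) = 0
      rw [h2, h1, map_zero]
    exact (Submodule.starProjection_eq_self_iff.2 hx).symm
  have h4 : P * G = P * G * P := by
    have := congrArg star h3
    simpa only [star_mul, hPs, hG.star_eq, mul_assoc] using this
  exact h3.trans h4.symm

/-- The spectral projection of a self-adjoint operator for the half-line `(-∞, t]`. -/
noncomputable def spectralProj (B : H →L[ℂ] H) (t : ℝ) : H →L[ℂ] H :=
  (LinearMap.ker (cfc (fun x : ℝ => max (x - t) 0) B).toLinearMap).starProjection

theorem isStarProjection_spectralProj (B : H →L[ℂ] H) (t : ℝ) :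
    IsStarProjection (spectralProj B t) :=
  isStarProjection_starProjection

theorem commute_spectralProj {B G : H →L[ℂ] H} (t : ℝ) (hG : IsSelfAdjoint G)
    (h : Commute G B) : Commute G (spectralProj B t) :=
  commute_starProjection_ker hG (h.symm.cfc_real _).symm

theorem cfc_posPart_mul_spectralProj (B : H →L[ℂ] H) (t : ℝ) :
    cfc (fun x : ℝ => max (x - t) 0) B * spectralProj B t = 0 := by
  ext x
  exact Submodule.starProjection_apply_mem
    (LinearMap.ker (cfc (fun x : ℝ => max (x - t) 0) B).toLinearMap) x

/-- Since (x - t)₊ (t - x)₊ = 0, the range of the negative part lies in the kernel onto which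
`spectralProj B t` projects. -/
theorem cfc_negPart_mul_one_sub_spectralProj (B : H →L[ℂ] H) (t : ℝ) :
    cfc (fun x : ℝ => max (t - x) 0) B * (1 - spectralProj B t) = 0 := by
  set N := cfc (fun x : ℝ => max (t - x) 0) B with hN
  have hNs : IsSelfAdjoint N := cfc_predicate _ _
  have hc : Commute N (spectralProj B t) :=
    commute_spectralProj t hNs ((Commute.refl B).cfc_real _)
  have h1 : cfc (fun x : ℝ => max (x - t) 0) B * N = 0 := by
    rw [hN, ← cfc_mul _ _ B]
    convert cfc_zero ℝ B using 2
    ext x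
    rcases le_total x t with h | h
    · simp [h]
    · simp [h]
  have h2 : spectralProj B t * N = N := by
    ext x
    refine Submodule.starProjection_eq_self_iff.2 ?_
    exact congrArg (fun T : H →L[ℂ] H => T x) h1
  rw [mul_sub, mul_one, hc.eq, h2, sub_self]

end Operators

/-! ### Strong convergence and functional calculus -/

section Operators

variable {H : Type*} [NormedAddCommGroup H] [InnerProductSpace ℂ H] [CompleteSpace H]

theorem isSelfAdjoint_of_algebraMap_le {T : H →L[ℂ] H} {c : ℝ}
    (h : algebraMap ℝ (H →L[ℂ] H) c ≤ T) : IsSelfAdjoint T := by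
  have h1 : IsSelfAdjoint (T - algebraMap ℝ (H →L[ℂ] H) c) :=
    IsSelfAdjoint.of_nonneg (sub_nonneg.2 h)
  have h2 : IsSelfAdjoint (algebraMap ℝ (H →L[ℂ] H) c) := IsSelfAdjoint.algebraMap _ (.all c)
  simpa using h1.add h2

theorem spectrum_subset_Icc {T : H →L[ℂ] H} {c C : ℝ}
    (h : algebraMap ℝ (H →L[ℂ] H) c ≤ T) (h' : T ≤ algebraMap ℝ (H →L[ℂ] H) C) :
    spectrum ℝ T ⊆ Set.Icc c C := by
  have hs := isSelfAdjoint_of_algebraMap_le h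
  exact fun x hx => ⟨(algebraMap_le_iff_le_spectrum hs).1 h x hx,
    (le_algebraMap_iff_spectrum_le hs).1 h' x hx⟩

theorem norm_apply_sq_le_of_nonneg {D : H →L[ℂ] H} (hD : 0 ≤ D) (x : H) :
    ‖D x‖ ^ 2 ≤ ‖D‖ * (inner ℂ (D x) x).re := by
  obtain ⟨R, hR⟩ := CStarAlgebra.nonneg_iff_eq_star_mul_self.1 hD
  have h1 : ‖D‖ = ‖R‖ * ‖R‖ := by rw [hR, CStarRing.norm_star_mul_self]
  have h2 : (inner ℂ (D x) x).re = ‖R x‖ ^ 2 := by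
    rw [hR]
    change (inner ℂ ((ContinuousLinearMap.adjoint R) (R x)) x).re = _
    rw [ContinuousLinearMap.adjoint_inner_left]
    exact inner_self_eq_norm_sq (𝕜 := ℂ) (R x)
  have h3 : ‖D x‖ ≤ ‖R‖ * ‖R x‖ := by
    rw [hR, ← norm_star R]
    exact (star R).le_opNorm (R x)
  calc ‖D x‖ ^ 2 ≤ (‖R‖ * ‖R x‖) ^ 2 := by gcongr
    _ = _ := by rw [h1, h2]; ring

namespace SOTTendsto

omit [CompleteSpace H] in
theorem unique {T : ℕ → H →L[ℂ] H} {L L' : H →L[ℂ] H} (h : SOTTendsto T L)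
    (h' : SOTTendsto T L') : L = L' := by
  ext x
  exact tendsto_nhds_unique (h x) (h' x)

omit [CompleteSpace H] in
theorem const (L : H →L[ℂ] H) : SOTTendsto (fun _ => L) L :=
  fun _ => tendsto_const_nhds

omit [CompleteSpace H] in
theorem add {S T : ℕ → H →L[ℂ] H} {L L' : H →L[ℂ] H} (h : SOTTendsto S L)
    (h' : SOTTendsto T L') : SOTTendsto (fun k => S k + T k) (L + L') :=
  fun x => (h x).add (h' x)

omit [CompleteSpace H] in
theorem sub {S T : ℕ → H →L[ℂ] H} {L L' : H →L[ℂ] H} (h : SOTTendsto S L)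
    (h' : SOTTendsto T L') : SOTTendsto (fun k => S k - T k) (L - L') :=
  fun x => (h x).sub (h' x)

theorem exists_norm_le {T : ℕ → H →L[ℂ] H} {L : H →L[ℂ] H} (h : SOTTendsto T L) :
    ∃ C, ∀ k, ‖T k‖ ≤ C := by
  refine banach_steinhaus fun x => ?_
  obtain ⟨C, hC⟩ := (h x).norm.bddAbove_range
  exact ⟨C, fun k => hC ⟨k, rfl⟩⟩

/-- Strongly convergent sequences are norm bounded by Banach–Steinhaus, which makes multiplication
sequentially continuous in both factors together. -/
theorem mul {S T : ℕ → H →L[ℂ] H} {L L' : H →L[ℂ] H} (h : SOTTendsto S L)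
    (h' : SOTTendsto T L') : SOTTendsto (fun k => S k * T k) (L * L') := by
  intro x
  obtain ⟨C, hC⟩ := h.exists_norm_le
  have h1 : Tendsto (fun k => S k (T k x - L' x)) atTop (𝓝 0) := by
    refine squeeze_zero_norm (a := fun k => C * ‖T k x - L' x‖)
      (fun k => (S k).le_of_opNorm_le (hC k) _) ?_
    simpa using ((tendsto_iff_norm_sub_tendsto_zero.1 (h' x)).const_mul C)
  have h2 := h1.add (h (L' x))
  simpa using h2

theorem aeval {T : ℕ → H →L[ℂ] H} {L : H →L[ℂ] H} (h : SOTTendsto T L) (p : Polynomial ℝ) :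
    SOTTendsto (fun k => Polynomial.aeval (T k) p) (Polynomial.aeval L p) := by
  induction p using Polynomial.induction_on with
  | C a => simpa using const _
  | add p q hp hq => simpa using hp.add hq
  | monomial n a ih => simpa [pow_succ, ← mul_assoc] using ih.mul h

omit [CompleteSpace H] in
theorem nonneg {T : ℕ → H →L[ℂ] H} {L : H →L[ℂ] H} (h : SOTTendsto T L) (hT : ∀ k, 0 ≤ T k) :
    0 ≤ L := by
  rw [ContinuousLinearMap.nonneg_iff_isPositive, ContinuousLinearMap.isPositive_iff_complex]
  intro x
  have h1 : Tendsto (fun k => inner ℂ (T k x) x) atTop (𝓝 (inner ℂ (L x) x)) :=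
    (h x).inner tendsto_const_nhds
  have h2 := (Complex.continuous_re.tendsto _).comp h1
  have h3 := fun k => (ContinuousLinearMap.isPositive_iff_complex _).1
    ((ContinuousLinearMap.nonneg_iff_isPositive _).1 (hT k)) x
  refine ⟨tendsto_nhds_unique ((Complex.continuous_ofReal.tendsto _).comp h2) ?_,
    ge_of_tendsto' h2 fun k => (h3 k).2⟩
  exact h1.congr fun k => ((h3 k).1).symm

theorem le {S T : ℕ → H →L[ℂ] H} {L L' : H →L[ℂ] H} (h : SOTTendsto S L)
    (h' : SOTTendsto T L') (hST : ∀ k, S k ≤ T k) : L ≤ L' :=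
  sub_nonneg.1 ((h'.sub h).nonneg fun k => sub_nonneg.2 (hST k))

omit [CompleteSpace H] in
theorem comp {T : ℕ → H →L[ℂ] H} {L : H →L[ℂ] H} (h : SOTTendsto T L) {φ : ℕ → ℕ}
    (hφ : Tendsto φ atTop atTop) : SOTTendsto (fun k => T (φ k)) L :=
  fun x => (h x).comp hφ

theorem le_of_antitone {T : ℕ → H →L[ℂ] H} {L : H →L[ℂ] H} (h : SOTTendsto T L)
    (hT : Antitone T) (k : ℕ) : L ≤ T k :=
  (h.comp (tendsto_add_atTop_nat k)).le (const (T k)) fun m => hT (Nat.le_add_left k m)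

theorem ge_of_monotone {T : ℕ → H →L[ℂ] H} {L : H →L[ℂ] H} (h : SOTTendsto T L)
    (hT : Monotone T) (k : ℕ) : T k ≤ L :=
  (const (T k)).le (h.comp (tendsto_add_atTop_nat k)) fun m => hT (Nat.le_add_left k m)

/-- Polynomials pass to the limit by `aeval`. All the spectra lie in [c, C], so a Weierstrass
approximation of f is uniform in k. -/
theorem cfc {T : ℕ → H →L[ℂ] H} {L : H →L[ℂ] H} (h : SOTTendsto T L) {c C : ℝ}
    (hc : ∀ k, algebraMap ℝ (H →L[ℂ] H) c ≤ T k) (hC : ∀ k, T k ≤ algebraMap ℝ (H →L[ℂ] H) C)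
    {f : ℝ → ℝ} (hf : ContinuousOn f (Set.Icc c C)) :
    SOTTendsto (fun k => _root_.cfc f (T k)) (_root_.cfc f L) := by
  have hcL : algebraMap ℝ (H →L[ℂ] H) c ≤ L := (const _).le h hc
  have hCL : L ≤ algebraMap ℝ (H →L[ℂ] H) C := h.le (const _) hC
  have approx : ∀ (p : Polynomial ℝ) (ε : ℝ), 0 < ε →
      (∀ x ∈ Set.Icc c C, |p.eval x - f x| < ε) → ∀ S : H →L[ℂ] H,
      algebraMap ℝ (H →L[ℂ] H) c ≤ S → S ≤ algebraMap ℝ (H →L[ℂ] H) C →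
      ‖Polynomial.aeval S p - _root_.cfc f S‖ ≤ ε := by
    intro p ε hε hp S hS hS'
    have hsa := isSelfAdjoint_of_algebraMap_le hS
    have hsp := spectrum_subset_Icc hS hS'
    rw [← cfc_polynomial p S, ← cfc_sub _ _ S (by fun_prop) (hf.mono hsp)]
    exact norm_cfc_le hε.le fun x hx => (hp x (hsp hx)).le
  intro x
  rw [Metric.tendsto_atTop]
  intro ε hε
  set δ := ε / (3 * (‖x‖ + 1)) with hδ
  have hδ0 : 0 < δ := by positivity
  have hδx : δ * ‖x‖ < ε / 3 := by
    have : δ * (‖x‖ + 1) = ε / 3 := by rw [hδ]; field_simp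
    nlinarith
  obtain ⟨p, hp⟩ := exists_polynomial_near_of_continuousOn c C f hf δ hδ0
  obtain ⟨N, hN⟩ := Metric.tendsto_atTop.1 (h.aeval p x) (ε / 3) (by positivity)
  refine ⟨N, fun k hk => ?_⟩
  have h1 : dist (_root_.cfc f (T k) x) (Polynomial.aeval (T k) p x) ≤ δ * ‖x‖ := by
    rw [dist_comm, dist_eq_norm]
    exact (Polynomial.aeval (T k) p - _root_.cfc f (T k)).le_of_opNorm_le
      (approx p δ hδ0 hp _ (hc k) (hC k)) x
  have h2 : dist (Polynomial.aeval L p x) (_root_.cfc f L x) ≤ δ * ‖x‖ := by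
    rw [dist_eq_norm]
    exact (Polynomial.aeval L p - _root_.cfc f L).le_of_opNorm_le
      (approx p δ hδ0 hp _ hcL hCL) x
  have h3 := hN k hk
  have h4 := dist_triangle4 (_root_.cfc f (T k) x) (Polynomial.aeval (T k) p x)
    (Polynomial.aeval L p x) (_root_.cfc f L x)
  linarith

end SOTTendsto

/-- A decreasing sequence of positive operators converges strongly. -/
theorem exists_sotTendsto_of_antitone {T : ℕ → H →L[ℂ] H} (hT : Antitone T)
    (h0 : ∀ k, 0 ≤ T k) : ∃ L, SOTTendsto T L := by
  have key : ∀ x, ∃ y, Tendsto (fun k => T k x) atTop (𝓝 y) := by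
    intro x
    set a : ℕ → ℝ := fun k => (inner ℂ (T k x) x).re with ha
    have hinner : ∀ D : H →L[ℂ] H, 0 ≤ D → 0 ≤ (inner ℂ (D x) x).re := fun D hD =>
      ((ContinuousLinearMap.nonneg_iff_isPositive _).1 hD).re_inner_nonneg_left x
    have hsub : ∀ m k, (inner ℂ ((T m - T k) x) x).re = a m - a k := by
      intro m k
      simp [ha]
    have hanti : Antitone a := fun m k hmk => by
      have := hinner _ (sub_nonneg.2 (hT hmk))
      rw [hsub] at this
      linarith
    have hbdd : BddBelow (Set.range a) := ⟨0, by rintro _ ⟨k, rfl⟩; exact hinner _ (h0 k)⟩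
    have hlim := tendsto_atTop_ciInf hanti hbdd
    -- The quadratic forms a k decrease to a limit, and ‖(T m - T k)x‖² ≤ ‖T 0‖ (a m - a k) turns
    -- this into a Cauchy estimate in norm.
    refine cauchySeq_tendsto_of_complete
      (cauchySeq_of_le_tendsto_0' (fun m => √(‖T 0‖ * (a m - ⨅ i, a i))) ?_ ?_)
    · intro m k hmk
      have hD : 0 ≤ T m - T k := sub_nonneg.2 (hT hmk)
      rw [dist_eq_norm]
      refine Real.le_sqrt_of_sq_le ((norm_apply_sq_le_of_nonneg hD x).trans ?_)
      rw [hsub]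
      have h1 : ‖T m - T k‖ ≤ ‖T 0‖ := CStarAlgebra.norm_le_norm_of_nonneg_of_le hD
        ((sub_le_self _ (h0 k)).trans (hT (Nat.zero_le m)))
      have h2 : 0 ≤ a m - a k := sub_nonneg.2 (hanti hmk)
      have h3 : ⨅ i, a i ≤ a k := ciInf_le hbdd k
      gcongr
    · have h1 := ((hlim.sub_const (⨅ i, a i)).const_mul ‖T 0‖).sqrt
      simpa using h1
  choose y hy using key
  refine ⟨continuousLinearMapOfTendsto T (f := y) (tendsto_pi_nhds.2 hy), hy⟩

end Operators

/-! ### Transformer equality and commutation with projections -/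

section Means

variable {H : Type*} [NormedAddCommGroup H] [InnerProductSpace ℂ H] [CompleteSpace H]

theorem conjugate_mono_of_isSelfAdjoint {C A B : H →L[ℂ] H} (hC : IsSelfAdjoint C) (h : A ≤ B) :
    C * A * C ≤ C * B * C := by
  have := star_left_conjugate_le_conjugate h C
  rwa [hC.star_eq] at this

theorem units_inv_nonneg_of_nonneg (u : (H →L[ℂ] H)ˣ) (h : 0 ≤ (u : H →L[ℂ] H)) :
    0 ≤ ((u⁻¹ : (H →L[ℂ] H)ˣ) : H →L[ℂ] H) := by
  rw [← CFC.rpow_neg_one_eq_inv u h]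
  exact CFC.rpow_nonneg

open Classical in
/-- The extension by zero of a binary operation on positive operators to all bounded operators. -/
noncomputable def opMean (σ : PosOp H → PosOp H → PosOp H) (A B : H →L[ℂ] H) : H →L[ℂ] H :=
  if h : 0 ≤ A ∧ 0 ≤ B then (σ ⟨A, h.1⟩ ⟨B, h.2⟩).1 else 0

theorem opMean_of_nonneg (σ : PosOp H → PosOp H → PosOp H) {A B : H →L[ℂ] H} (hA : 0 ≤ A)
    (hB : 0 ≤ B) : opMean σ A B = (σ ⟨A, hA⟩ ⟨B, hB⟩).1 :=
  dif_pos ⟨hA, hB⟩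

theorem opMean_coe (σ : PosOp H → PosOp H → PosOp H) (A B : PosOp H) :
    opMean σ A.1 B.1 = (σ A B).1 :=
  opMean_of_nonneg σ A.2 B.2

theorem opMean_nonneg (σ : PosOp H → PosOp H → PosOp H) (A B : H →L[ℂ] H) :
    0 ≤ opMean σ A B := by
  unfold opMean
  split_ifs with h
  · exact (σ _ _).2
  · exact le_rfl

namespace IsOperatorMean

variable {σ : PosOp H → PosOp H → PosOp H} (hσ : IsOperatorMean σ)
include hσ

theorem opMean_mono {A B C D : H →L[ℂ] H} (hA : 0 ≤ A) (hB : 0 ≤ B) (hAC : A ≤ C)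
    (hBD : B ≤ D) : opMean σ A B ≤ opMean σ C D := by
  rw [opMean_of_nonneg σ hA hB, opMean_of_nonneg σ (hA.trans hAC) (hB.trans hBD)]
  exact hσ.monotone _ _ _ _ hAC hBD

theorem opMean_one_one : opMean σ 1 1 = 1 := by
  rw [opMean_of_nonneg σ zero_le_one zero_le_one]
  exact congrArg Subtype.val hσ.normalized

theorem opMean_transformer {A B C : H →L[ℂ] H} (hA : 0 ≤ A) (hB : 0 ≤ B) (hC : 0 ≤ C) :
    C * opMean σ A B * C ≤ opMean σ (C * A * C) (C * B * C) := by
  have h := hσ.transformer ⟨A, hA⟩ ⟨B, hB⟩ ⟨C, hC⟩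
  rw [opMean_of_nonneg σ hA hB]
  rw [show opMean σ (C * A * C) (C * B * C) = _ from
    opMean_coe σ (PosOp.sandwich ⟨C, hC⟩ ⟨A, hA⟩) (PosOp.sandwich ⟨C, hC⟩ ⟨B, hB⟩)]
  exact h

/-- The reverse inequality is the transformer inequality for C⁻¹, conjugated back by C. -/
theorem opMean_conjugate {A B C : H →L[ℂ] H} (hA : 0 ≤ A) (hB : 0 ≤ B) (hC : 0 ≤ C)
    (hCu : IsUnit C) : C * opMean σ A B * C = opMean σ (C * A * C) (C * B * C) := by
  refine le_antisymm (hσ.opMean_transformer hA hB hC) ?_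
  obtain ⟨u, rfl⟩ := hCu
  have hD := units_inv_nonneg_of_nonneg u hC
  have hs := IsSelfAdjoint.of_nonneg hC
  have hpos : ∀ {X : H →L[ℂ] H}, 0 ≤ X → 0 ≤ (u : H →L[ℂ] H) * X * u := fun hX => by
    simpa using conjugate_mono_of_isSelfAdjoint hs hX
  have hcancel : ∀ X : H →L[ℂ] H,
      ((u⁻¹ : (H →L[ℂ] H)ˣ) : H →L[ℂ] H) * (u * X * u) * ((u⁻¹ : (H →L[ℂ] H)ˣ) : H →L[ℂ] H) = X := by
    intro X
    simp [mul_assoc]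
  have h1 := hσ.opMean_transformer (hpos hA) (hpos hB) hD
  rw [hcancel, hcancel] at h1
  have h2 := conjugate_mono_of_isSelfAdjoint hs h1
  simpa [mul_assoc] using h2

theorem projection_opMean_le {P A B A' B' : H →L[ℂ] H} (hP : IsStarProjection P) (hA : 0 ≤ A)
    (hB : 0 ≤ B) (hAA' : P * A * P ≤ A') (hBB' : P * B * P ≤ B') :
    P * opMean σ A B * P ≤ opMean σ A' B' := by
  have hpos : ∀ {X : H →L[ℂ] H}, 0 ≤ X → 0 ≤ P * X * P := fun hX => by
    simpa using conjugate_mono_of_isSelfAdjoint hP.isSelfAdjoint hX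
  exact (hσ.opMean_transformer hA hB hP.nonneg).trans
    (hσ.opMean_mono (hpos hA) (hpos hB) hAA' hBB')

omit hσ in
theorem projection_conjugate_le_of_commute {P A : H →L[ℂ] H} (hP : IsStarProjection P)
    (hA : 0 ≤ A) (h : Commute P A) : P * A * P ≤ A := by
  have hPP : P * P = P := hP.isIdempotentElem
  have h1 := conjugate_mono_of_isSelfAdjoint hP.one_sub.isSelfAdjoint hA
  have h2 : (1 - P) * A * (1 - P) = A - P * A * P := by
    have h3 : P * A * P = P * A := by rw [h.eq, mul_assoc, hPP]
    simp only [sub_mul, mul_sub, one_mul, mul_one, h3, h.eq.symm]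
    abel
  rw [mul_zero, zero_mul, h2] at h1
  exact sub_nonneg.1 h1

/-- For P commuting with A and B, PAP ≤ A and PBP ≤ B, so the transformer inequality yields P(A σ
B)P ≤ A σ B, which already forces commutation. -/
theorem commute_opMean {P A B : H →L[ℂ] H} (hP : IsStarProjection P) (hA : 0 ≤ A) (hB : 0 ≤ B)
    (hPA : Commute P A) (hPB : Commute P B) : Commute P (opMean σ A B) :=
  hP.commute_of_conjugate_le (IsSelfAdjoint.of_nonneg (opMean_nonneg σ A B))
    (hσ.projection_opMean_le hP hA hB (projection_conjugate_le_of_commute hP hA hPA)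
      (projection_conjugate_le_of_commute hP hB hPB))

end IsOperatorMean

open scoped ComplexOrder in
/-- A positive operator commuting with all projections of rank one is a scalar. -/
theorem exists_eq_algebraMap_of_commute {F : H →L[ℂ] H} (hF : 0 ≤ F)
    (h : ∀ P : H →L[ℂ] H, IsStarProjection P → Commute P F) :
    F = algebraMap ℝ (H →L[ℂ] H) ‖F‖ := by
  rcases subsingleton_or_nontrivial H with hH | hH
  · exact Subsingleton.elim _ _
  -- Commuting with the projection onto ℂv makes v an eigenvector; an operator for which every
  -- vector is an eigenvector is scalar.
  have h1 : ∀ v, ¬ LinearIndependent ℂ ![v, F.toLinearMap v] := by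
    intro v hv
    have hv0 : v ≠ 0 := hv.ne_zero 0
    have hP : IsStarProjection (ℂ ∙ v).starProjection := isStarProjection_starProjection
    have h2 : (ℂ ∙ v).starProjection (F v) = F v := by
      have h3 := congrArg (fun T : H →L[ℂ] H => T v) (h _ hP).eq
      change (ℂ ∙ v).starProjection (F v) = F ((ℂ ∙ v).starProjection v) at h3
      rwa [Submodule.starProjection_eq_self_iff.2 (Submodule.mem_span_singleton_self v)] at h3
    obtain ⟨c, hc⟩ := Submodule.mem_span_singleton.1 (Submodule.starProjection_eq_self_iff.1 h2)
    have h4 := LinearIndependent.pair_iff.1 hv c (-1) (by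
      rw [hc]; simp)
    simp at h4
  obtain ⟨a, ha⟩ := LinearMap.exists_eq_smul_id_of_forall_notLinearIndependent h1
  have hFa : F = algebraMap ℂ (H →L[ℂ] H) a := by
    ext x
    simpa [Algebra.algebraMap_eq_smul_one] using congrArg (fun T : H →ₗ[ℂ] H => T x) ha
  have hspec : a ∈ spectrum ℂ F := by
    rw [hFa, spectrum.scalar_eq]; rfl
  have ha0 : 0 ≤ a := spectrum_nonneg_of_nonneg hF hspec
  have hn : ‖F‖ = ‖a‖ := by rw [hFa, norm_algebraMap']
  rw [hn, hFa]
  have : a = ((‖a‖ : ℝ) : ℂ) := (Complex.norm_of_nonneg' ha0).symm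
  conv_lhs => rw [this]
  rfl

end Means

/-! ### The representing function -/

section RepresentingFunction

variable {H : Type*} [NormedAddCommGroup H] [InnerProductSpace ℂ H] [CompleteSpace H]

/-- The representing function of an operator mean, `1 σ t = f t`. -/
noncomputable def repFun (σ : PosOp H → PosOp H → PosOp H) (t : ℝ) : ℝ :=
  ‖opMean σ 1 (algebraMap ℝ (H →L[ℂ] H) t)‖

omit [CompleteSpace H] in
theorem algebraMap_mul_comm_conj (C : H →L[ℂ] H) (t : ℝ) :
    C * algebraMap ℝ (H →L[ℂ] H) t * C = algebraMap ℝ (H →L[ℂ] H) t * (C * C) := by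
  rw [← Algebra.commutes, mul_assoc]

namespace IsOperatorMean

variable {σ : PosOp H → PosOp H → PosOp H} (hσ : IsOperatorMean σ)
include hσ

theorem opMean_one_algebraMap {t : ℝ} (ht : 0 ≤ t) :
    opMean σ 1 (algebraMap ℝ (H →L[ℂ] H) t) = algebraMap ℝ (H →L[ℂ] H) (repFun σ t) :=
  exists_eq_algebraMap_of_commute (opMean_nonneg σ _ _) fun _ hP =>
    hσ.commute_opMean hP zero_le_one (algebraMap_nonneg _ ht) (Commute.one_right _)
      (Algebra.commutes _ _).symm

theorem opMean_algebraMap_mul_self {G : H →L[ℂ] H} (hG : 0 ≤ G) (hGu : IsUnit G) {t : ℝ}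
    (ht : 0 ≤ t) : opMean σ G (algebraMap ℝ (H →L[ℂ] H) t * G) =
      algebraMap ℝ (H →L[ℂ] H) (repFun σ t) * G := by
  have hC : 0 ≤ CFC.sqrt G := CFC.sqrt_nonneg G
  have hCC : CFC.sqrt G * CFC.sqrt G = G := CFC.sqrt_mul_sqrt_self G
  have hCu : IsUnit (CFC.sqrt G) := by
    have hc : Commute (CFC.sqrt G) (CFC.sqrt G) := Commute.refl _
    exact (hc.isUnit_mul_iff.1 (by rwa [hCC])).1
  have h := hσ.opMean_conjugate zero_le_one (algebraMap_nonneg (H →L[ℂ] H) ht) hC hCu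
  rw [hσ.opMean_one_algebraMap ht, algebraMap_mul_comm_conj, algebraMap_mul_comm_conj, mul_one,
    hCC] at h
  exact h.symm

theorem opMean_algebraMap_mul {r : ℝ} (hr : 0 < r) {A B : H →L[ℂ] H} (hA : 0 ≤ A) (hB : 0 ≤ B) :
    opMean σ (algebraMap ℝ (H →L[ℂ] H) r * A) (algebraMap ℝ (H →L[ℂ] H) r * B) =
      algebraMap ℝ (H →L[ℂ] H) r * opMean σ A B := by
  have hs : (algebraMap ℝ (H →L[ℂ] H) √r) * (algebraMap ℝ (H →L[ℂ] H) √r) =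
      algebraMap ℝ (H →L[ℂ] H) r := by rw [← map_mul, Real.mul_self_sqrt hr.le]
  have hconj : ∀ X : H →L[ℂ] H, (algebraMap ℝ (H →L[ℂ] H) √r) * X * (algebraMap ℝ (H →L[ℂ] H) √r)
      = algebraMap ℝ (H →L[ℂ] H) r * X := by
    intro X
    rw [mul_assoc, ← Algebra.commutes, ← mul_assoc, hs]
  have h := hσ.opMean_conjugate hA hB (algebraMap_nonneg (H →L[ℂ] H) (Real.sqrt_nonneg r))
    ((Real.sqrt_pos.2 hr).ne'.isUnit.map (algebraMap ℝ (H →L[ℂ] H)))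
  rw [hconj, hconj, hconj] at h
  exact h.symm

section Nontrivial

variable [Nontrivial H]

theorem repFun_one : repFun σ 1 = 1 := by
  rw [repFun, map_one, hσ.opMean_one_one, norm_one]

omit hσ in
theorem algebraMap_le_algebraMap_iff {a b : ℝ} :
    algebraMap ℝ (H →L[ℂ] H) a ≤ algebraMap ℝ (H →L[ℂ] H) b ↔ a ≤ b := by
  refine ⟨fun h => ?_, fun h => algebraMap_mono _ h⟩
  obtain ⟨v, hv⟩ := exists_ne (0 : H)
  have h1 := ((ContinuousLinearMap.le_def _ _).1 h).re_inner_nonneg_left v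
  have h2 : (algebraMap ℝ (H →L[ℂ] H) b - algebraMap ℝ (H →L[ℂ] H) a) v = ((b - a : ℝ) : ℂ) • v := by
    rw [← map_sub, Algebra.algebraMap_eq_smul_one]
    rfl
  rw [h2, inner_smul_left] at h1
  have h3 : (0 : ℝ) ≤ (b - a) * ‖v‖ ^ 2 := by
    have h4 : inner ℂ v v = ((‖v‖ ^ 2 : ℝ) : ℂ) := by
      simp [inner_self_eq_norm_sq_to_K]
    rw [h4, Complex.conj_ofReal, ← Complex.ofReal_mul] at h1
    exact h1
  have h5 : 0 < ‖v‖ ^ 2 := by positivity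
  nlinarith [nonneg_of_mul_nonneg_left h3 h5]

theorem repFun_mono {s t : ℝ} (hs : 0 ≤ s) (hst : s ≤ t) : repFun σ s ≤ repFun σ t := by
  rw [← algebraMap_le_algebraMap_iff (H := H), ← hσ.opMean_one_algebraMap hs,
    ← hσ.opMean_one_algebraMap (hs.trans hst)]
  exact hσ.opMean_mono zero_le_one (algebraMap_nonneg _ hs) le_rfl (algebraMap_mono _ hst)

/-- Raising the first argument from 1 to t/s gives 1 σ t ≤ (t/s) σ t = (t/s)(1 σ s); thus f(t)/t is
nonincreasing. -/
theorem repFun_le_div_mul {s t : ℝ} (hs : 0 < s) (hst : s ≤ t) :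
    repFun σ t ≤ t / s * repFun σ s := by
  have h1 : 1 ≤ t / s := (one_le_div hs).2 hst
  have h0 : 0 < t / s := one_pos.trans_le h1
  have h2 := hσ.opMean_algebraMap_mul h0 zero_le_one (algebraMap_nonneg (H →L[ℂ] H) hs.le)
  rw [hσ.opMean_one_algebraMap hs.le, mul_one, ← map_mul, ← map_mul, div_mul_cancel₀ t hs.ne'] at h2
  rw [← algebraMap_le_algebraMap_iff (H := H), ← h2, ← hσ.opMean_one_algebraMap (hs.le.trans hst)]
  refine hσ.opMean_mono zero_le_one (algebraMap_nonneg _ (hs.le.trans hst)) ?_ le_rfl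
  rw [← map_one (algebraMap ℝ (H →L[ℂ] H))]
  exact algebraMap_mono _ h1

theorem repFun_pos {t : ℝ} (ht : 0 < t) : 0 < repFun σ t := by
  rcases le_total 1 t with h | h
  · have := hσ.repFun_mono zero_le_one h
    rw [hσ.repFun_one] at this
    linarith
  · have h1 := hσ.repFun_le_div_mul ht h
    rw [hσ.repFun_one] at h1
    have h2 : 0 < 1 / t := by positivity
    by_contra h3
    nlinarith

/-- The two monotonicities, of f and of f(t)/t, combine into a Lipschitz bound on [c, C]. This
drives both the continuity of f and the bisection proof of 1 σ B = f(B). -/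
theorem repFun_sub_le {c C s t : ℝ} (hc : 0 < c) (hs : c ≤ s) (hst : s ≤ t) (ht : t ≤ C) :
    repFun σ t - repFun σ s ≤ repFun σ C / c * (t - s) := by
  have hs0 : 0 < s := hc.trans_le hs
  have h1 := hσ.repFun_le_div_mul hs0 hst
  have h2 : repFun σ s ≤ repFun σ C := hσ.repFun_mono hs0.le (hst.trans ht)
  have h3 := hσ.repFun_pos hs0
  calc repFun σ t - repFun σ s ≤ t / s * repFun σ s - repFun σ s := by linarith
    _ = repFun σ s / s * (t - s) := by field_simp
    _ ≤ repFun σ C / c * (t - s) := by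
      have : 0 ≤ t - s := sub_nonneg.2 hst
      gcongr
      linarith

theorem continuousOn_repFun {c C : ℝ} (hc : 0 < c) : ContinuousOn (repFun σ) (Set.Icc c C) := by
  rcases le_or_gt C 0 with hC | hC
  · rw [Set.Icc_eq_empty (by linarith)]
    exact continuousOn_empty _
  have hK : 0 ≤ repFun σ C / c := div_nonneg (hσ.repFun_pos hC).le hc.le
  refine (LipschitzOnWith.of_dist_le_mul (K := ⟨_, hK⟩) fun x hx y hy => ?_).continuousOn
  change dist _ _ ≤ repFun σ C / c * dist x y
  rw [Real.dist_eq, Real.dist_eq]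
  rcases le_total x y with h | h
  · have h1 := hσ.repFun_mono (hc.le.trans hx.1) h
    rw [abs_sub_comm, abs_sub_comm x, abs_of_nonneg (by linarith), abs_of_nonneg (by linarith)]
    exact hσ.repFun_sub_le hc hx.1 h hy.2
  · have h1 := hσ.repFun_mono (hc.le.trans hy.1) h
    rw [abs_of_nonneg (by linarith), abs_of_nonneg (by linarith)]
    exact hσ.repFun_sub_le hc hy.1 h hx.2

end Nontrivial

end IsOperatorMean

end RepresentingFunction

/-! ### The identity 1 σ B = f(B) -/

section FunctionalCalculus

variable {H : Type*} [NormedAddCommGroup H] [InnerProductSpace ℂ H] [CompleteSpace H]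

theorem isUnit_of_algebraMap_le {T : H →L[ℂ] H} {c : ℝ} (hc : 0 < c)
    (h : algebraMap ℝ (H →L[ℂ] H) c ≤ T) : IsUnit T :=
  CStarAlgebra.isUnit_of_le _ h (IsStrictlyPositive.iff_of_unital.2
    ⟨algebraMap_nonneg _ hc.le, hc.ne'.isUnit.map (algebraMap ℝ (H →L[ℂ] H))⟩)

theorem nonneg_of_algebraMap_le {T : H →L[ℂ] H} {c : ℝ} (hc : 0 < c)
    (h : algebraMap ℝ (H →L[ℂ] H) c ≤ T) : 0 ≤ T :=
  (algebraMap_nonneg _ hc.le).trans h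

namespace IsOperatorMean

variable [Nontrivial H] {σ : PosOp H → PosOp H → PosOp H} (hσ : IsOperatorMean σ)
  {B : H →L[ℂ] H} {c C : ℝ} (hc : 0 < c)
  (hcB : algebraMap ℝ (H →L[ℂ] H) c ≤ B) (hBC : B ≤ algebraMap ℝ (H →L[ℂ] H) C)

section
include hσ hc hcB hBC

/-- Left of t, f is at most f(t); right of t, f(x) ≤ (x/t) f(t). The mean 1 σ B obeys the same
bound, and this common pair of bounds is what allows the comparison. -/
theorem cfc_repFun_le {t : ℝ} (ht : 0 < t) :
    cfc (repFun σ) B ≤ algebraMap ℝ (H →L[ℂ] H) (repFun σ t) +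
      algebraMap ℝ (H →L[ℂ] H) (repFun σ t / t) * cfc (fun x : ℝ => max (x - t) 0) B := by
  have hsa := isSelfAdjoint_of_algebraMap_le hcB
  have hsp := spectrum_subset_Icc hcB hBC
  rw [← Algebra.smul_def, ← cfc_smul _ _ B, ← cfc_const_add _ _ B]
  refine cfc_mono (fun x hx => ?_) ((hσ.continuousOn_repFun hc).mono hsp)
  have hx0 : 0 < x := hc.trans_le (hsp hx).1
  have hft := hσ.repFun_pos ht
  change repFun σ x ≤ repFun σ t + repFun σ t / t * max (x - t) 0
  rcases le_total x t with h | h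
  · rw [max_eq_right (by linarith), mul_zero, add_zero]
    exact hσ.repFun_mono hx0.le h
  · rw [max_eq_left (by linarith)]
    refine (hσ.repFun_le_div_mul ht h).trans_eq ?_
    field_simp
    ring

theorem le_cfc_repFun {t : ℝ} (ht : 0 < t) :
    algebraMap ℝ (H →L[ℂ] H) (repFun σ t) -
      algebraMap ℝ (H →L[ℂ] H) (repFun σ t / t) * cfc (fun x : ℝ => max (t - x) 0) B ≤
    cfc (repFun σ) B := by
  have hsa := isSelfAdjoint_of_algebraMap_le hcB
  have hsp := spectrum_subset_Icc hcB hBC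
  rw [← Algebra.smul_def, ← cfc_smul _ _ B, ← cfc_const _ B, ← cfc_sub _ _ B]
  refine cfc_mono (fun x hx => ?_) (by fun_prop) ((hσ.continuousOn_repFun hc).mono hsp)
  have hx0 : 0 < x := hc.trans_le (hsp hx).1
  have hft := hσ.repFun_pos ht
  change repFun σ t - repFun σ t / t * max (t - x) 0 ≤ repFun σ x
  rcases le_total x t with h | h
  · rw [max_eq_left (by linarith)]
    have h1 := hσ.repFun_le_div_mul hx0 h
    calc repFun σ t - repFun σ t / t * (t - x) = x / t * repFun σ t := by field_simp; ring
      _ ≤ x / t * (t / x * repFun σ x) := by gcongr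
      _ = repFun σ x := by field_simp
  · rw [max_eq_right (by linarith), mul_zero, sub_zero]
    exact hσ.repFun_mono ht.le h

omit [Nontrivial H] hBC in
-- With G = max(1, B/t) in the functional calculus, 1 ≤ G and B ≤ tG, so 1 σ B ≤ G σ tG = f(t)G.
theorem opMean_one_le {t : ℝ} (ht : 0 < t) :
    opMean σ 1 B ≤ algebraMap ℝ (H →L[ℂ] H) (repFun σ t) +
      algebraMap ℝ (H →L[ℂ] H) (repFun σ t / t) * cfc (fun x : ℝ => max (x - t) 0) B := by
  have hsa := isSelfAdjoint_of_algebraMap_le hcB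
  have hB := nonneg_of_algebraMap_le hc hcB
  set G := cfc (fun x : ℝ => 1 + t⁻¹ * max (x - t) 0) B with hG
  have hG1 : algebraMap ℝ (H →L[ℂ] H) 1 ≤ G := algebraMap_le_cfc _ _ _ fun x hx => by
    have : 0 ≤ t⁻¹ * max (x - t) 0 := by positivity
    linarith
  have hBG : B ≤ algebraMap ℝ (H →L[ℂ] H) t * G := by
    rw [← Algebra.smul_def, hG, ← cfc_smul _ _ B]
    conv_lhs => rw [← cfc_id ℝ B]
    refine cfc_mono (fun x hx => ?_)
    change x ≤ t * (1 + t⁻¹ * max (x - t) 0)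
    have : t * (1 + t⁻¹ * max (x - t) 0) = t + max (x - t) 0 := by field_simp
    rw [this]
    linarith [le_max_left (x - t) 0]
  have h := hσ.opMean_mono zero_le_one hB ((map_one _).symm.le.trans hG1) hBG
  rw [hσ.opMean_algebraMap_mul_self (nonneg_of_algebraMap_le one_pos hG1)
    (isUnit_of_algebraMap_le one_pos hG1) ht.le] at h
  refine h.trans_eq ?_
  rw [hG, cfc_const_add _ _ B, cfc_const_mul _ _ B, map_one, mul_add, mul_one, Algebra.smul_def,
    ← mul_assoc, ← map_mul, div_eq_mul_inv]

omit [Nontrivial H] hBC in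
-- Dual to `opMean_one_le`, with G = min(1, B/t), which is invertible because B ≥ c > 0.
theorem le_opMean_one {t : ℝ} (ht : 0 < t) :
    algebraMap ℝ (H →L[ℂ] H) (repFun σ t) -
      algebraMap ℝ (H →L[ℂ] H) (repFun σ t / t) * cfc (fun x : ℝ => max (t - x) 0) B ≤
    opMean σ 1 B := by
  have hsa := isSelfAdjoint_of_algebraMap_le hcB
  have hspec := (algebraMap_le_iff_le_spectrum hsa).1 hcB
  set G := cfc (fun x : ℝ => 1 - t⁻¹ * max (t - x) 0) B with hG
  have hGid : ∀ x : ℝ, t * (1 - t⁻¹ * max (t - x) 0) = min t x := by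
    intro x
    have : t * (1 - t⁻¹ * max (t - x) 0) = t - max (t - x) 0 := by field_simp
    rw [this]
    rcases le_total t x with h | h
    · rw [max_eq_right (by linarith), min_eq_left h, sub_zero]
    · rw [max_eq_left (by linarith), min_eq_right h]; ring
  have hd : 0 < min t c / t := by positivity
  have hG0 : algebraMap ℝ (H →L[ℂ] H) (min t c / t) ≤ G := algebraMap_le_cfc _ _ _ fun x hx => by
    rw [div_le_iff₀ ht, mul_comm, hGid]
    exact min_le_min_left _ (hspec x hx)
  have hG1 : G ≤ 1 := by
    rw [← map_one (algebraMap ℝ (H →L[ℂ] H))]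
    refine cfc_le_algebraMap _ _ _ fun x hx => ?_
    have : 0 ≤ t⁻¹ * max (t - x) 0 := by positivity
    linarith
  have hGp := nonneg_of_algebraMap_le hd hG0
  have hBG : algebraMap ℝ (H →L[ℂ] H) t * G ≤ B := by
    rw [← Algebra.smul_def, hG, ← cfc_smul _ _ B]
    conv_rhs => rw [← cfc_id ℝ B]
    refine cfc_mono (fun x hx => ?_)
    change t * (1 - t⁻¹ * max (t - x) 0) ≤ x
    rw [hGid]
    exact min_le_right _ _
  have hpos : 0 ≤ algebraMap ℝ (H →L[ℂ] H) t * G := by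
    rw [← Algebra.smul_def]
    exact smul_nonneg ht.le hGp
  have h := hσ.opMean_mono hGp hpos hG1 hBG
  rw [hσ.opMean_algebraMap_mul_self hGp (isUnit_of_algebraMap_le hd hG0) ht.le] at h
  refine le_of_eq_of_le ?_ h
  rw [hG, cfc_sub _ _ B, cfc_const _ B, cfc_const_mul _ _ B, map_one, mul_sub, mul_one,
    Algebra.smul_def, ← mul_assoc, ← map_mul, div_eq_mul_inv]

omit hcB hBC in
-- The conditions on R place its range in the spectral subspace of B for [s, t]. Compression by R
-- kills both correction terms and leaves f(t) - f(s). Since 1 σ B and f(B) satisfy both bounds,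
-- either may play X or Y.
theorem projection_sub_le {s t : ℝ} (hs : c ≤ s) (hst : s ≤ t) (ht : t ≤ C) {R X Y : H →L[ℂ] H}
    (hR : IsStarProjection R)
    (hRt : cfc (fun x : ℝ => max (x - t) 0) B * R = 0)
    (hRs : cfc (fun x : ℝ => max (s - x) 0) B * R = 0)
    (hX : X ≤ algebraMap ℝ (H →L[ℂ] H) (repFun σ t) +
      algebraMap ℝ (H →L[ℂ] H) (repFun σ t / t) * cfc (fun x : ℝ => max (x - t) 0) B)
    (hY : algebraMap ℝ (H →L[ℂ] H) (repFun σ s) -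
      algebraMap ℝ (H →L[ℂ] H) (repFun σ s / s) * cfc (fun x : ℝ => max (s - x) 0) B ≤ Y) :
    R * (X - Y) * R ≤ (repFun σ C / c * (t - s)) • R := by
  have hRR : R * R = R := hR.isIdempotentElem
  have h1 := conjugate_mono_of_isSelfAdjoint hR.isSelfAdjoint hX
  have h2 := conjugate_mono_of_isSelfAdjoint hR.isSelfAdjoint hY
  have e1 : ∀ r : ℝ, R * algebraMap ℝ (H →L[ℂ] H) r * R = r • R := fun r => by
    rw [algebraMap_mul_comm_conj, hRR, Algebra.smul_def]
  have e2 : ∀ (r : ℝ) (N : H →L[ℂ] H), N * R = 0 →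
      R * (algebraMap ℝ (H →L[ℂ] H) r * N) * R = 0 := fun r N hN => by
    rw [mul_assoc, mul_assoc, hN, mul_zero, mul_zero]
  rw [mul_add, add_mul, e1, e2 _ _ hRt, add_zero] at h1
  rw [mul_sub, sub_mul, e1, e2 _ _ hRs, sub_zero] at h2
  calc R * (X - Y) * R = R * X * R - R * Y * R := by rw [mul_sub, sub_mul]
    _ ≤ repFun σ t • R - repFun σ s • R := sub_le_sub h1 h2
    _ = (repFun σ t - repFun σ s) • R := (sub_smul _ _ _).symm
    _ ≤ _ := smul_le_smul_of_nonneg_right (hσ.repFun_sub_le hc hs hst ht) hR.nonneg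

/-- Bisection: the spectral projection Q at the midpoint commutes with 1 σ B and f(B), so their
difference is block diagonal for Q and the bounds on the two halves add up to a bound on R. Each
level halves the interval and hence the Lipschitz estimate. -/
theorem projection_opMean_sub_cfc_bounds (N : ℕ) {s t : ℝ} (hs : c ≤ s) (hst : s ≤ t) (ht : t ≤ C)
    {R : H →L[ℂ] H} (hR : IsStarProjection R) (hRB : Commute R B)
    (hRt : cfc (fun x : ℝ => max (x - t) 0) B * R = 0)
    (hRs : cfc (fun x : ℝ => max (s - x) 0) B * R = 0) :
    R * (opMean σ 1 B - cfc (repFun σ) B) * R ≤ (repFun σ C / c * ((t - s) / 2 ^ N)) • R ∧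
    R * (cfc (repFun σ) B - opMean σ 1 B) * R ≤ (repFun σ C / c * ((t - s) / 2 ^ N)) • R := by
  have hsa := isSelfAdjoint_of_algebraMap_le hcB
  induction N generalizing s t R with
  | zero =>
    have hs0 : 0 < s := hc.trans_le hs
    have ht0 : 0 < t := hs0.trans_le hst
    simp only [pow_zero, div_one]
    exact ⟨hσ.projection_sub_le hc hs hst ht hR hRt hRs (hσ.opMean_one_le hc hcB ht0)
        (hσ.le_cfc_repFun hc hcB hBC hs0),
      hσ.projection_sub_le hc hs hst ht hR hRt hRs (hσ.cfc_repFun_le hc hcB hBC ht0)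
        (hσ.le_opMean_one hc hcB hs0)⟩
  | succ N ih =>
    set m := (s + t) / 2 with hm
    set Q := spectralProj B m with hQdef
    have hQ : IsStarProjection Q := isStarProjection_spectralProj B m
    have hBQ : Commute B Q := commute_spectralProj m hsa (Commute.refl B)
    have hRQ : Commute R Q := commute_spectralProj m hR.isSelfAdjoint hRB
    have hP1 : IsStarProjection (R * Q) := hR.mul hQ hRQ
    have hRQ' : Commute R (1 - Q) := (Commute.one_right R).sub_right hRQ
    have hP2 : IsStarProjection (R * (1 - Q)) := hR.mul hQ.one_sub hRQ'
    have hQF : Commute Q (opMean σ 1 B) := hσ.commute_opMean hQ zero_le_one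
      (nonneg_of_algebraMap_le hc hcB) (Commute.one_right _) hBQ.symm
    have hQg : Commute Q (cfc (repFun σ) B) := (hBQ.cfc_real _).symm
    have b1 := ih hs (t := m) (by linarith) (by linarith) hP1 (hRB.mul_left hBQ.symm)
      (by rw [hRQ.eq, ← mul_assoc, hQdef, cfc_posPart_mul_spectralProj, zero_mul])
      (by rw [← mul_assoc, hRs, zero_mul])
    have b2 := ih (s := m) (by linarith) (by linarith) ht hP2
      (hRB.mul_left ((Commute.one_left B).sub_left hBQ.symm))
      (by rw [← mul_assoc, hRt, zero_mul])
      (by rw [hRQ'.eq, ← mul_assoc, hQdef, cfc_negPart_mul_one_sub_spectralProj, zero_mul])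
    have e1 : (m - s) / 2 ^ N = (t - s) / 2 ^ (N + 1) := by rw [hm]; field_simp; ring
    have e2 : (t - m) / 2 ^ N = (t - s) / 2 ^ (N + 1) := by rw [hm]; field_simp; ring
    rw [e1] at b1
    rw [e2] at b2
    have hsplit : ∀ E : H →L[ℂ] H, Commute Q E →
        R * E * R = (R * Q) * E * (R * Q) + (R * (1 - Q)) * E * (R * (1 - Q)) := by
      intro E hE
      have hQQ : Q * Q = Q := hQ.isIdempotentElem
      have h1 : (R * Q) * E * (R * Q) = R * E * R * Q := by
        calc (R * Q) * E * (R * Q) = R * (Q * E) * (Q * R) := by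
              rw [hRQ.eq]; simp only [mul_assoc]; rw [← mul_assoc Q R, ← hRQ.eq, mul_assoc]
          _ = R * E * (Q * Q) * R := by rw [hE.eq]; simp only [mul_assoc]
          _ = R * E * R * Q := by rw [hQQ, mul_assoc, ← hRQ.eq, ← mul_assoc]
      have hE' : Commute (1 - Q) E := (Commute.one_left E).sub_left hE
      have hQQ' : (1 - Q) * (1 - Q) = 1 - Q := hQ.one_sub.isIdempotentElem
      have h2 : (R * (1 - Q)) * E * (R * (1 - Q)) = R * E * R * (1 - Q) := by
        calc (R * (1 - Q)) * E * (R * (1 - Q)) = R * ((1 - Q) * E) * ((1 - Q) * R) := by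
              rw [← hRQ'.eq]; simp only [mul_assoc]
          _ = R * E * ((1 - Q) * (1 - Q)) * R := by rw [hE'.eq]; simp only [mul_assoc]
          _ = R * E * R * (1 - Q) := by rw [hQQ', mul_assoc, ← hRQ'.eq, ← mul_assoc]
      rw [h1, h2, ← mul_add, add_sub_cancel, mul_one]
    have hsum : R * Q + R * (1 - Q) = R := by rw [← mul_add, add_sub_cancel, mul_one]
    constructor
    · rw [hsplit _ (hQF.sub_right hQg)]
      refine (add_le_add b1.1 b2.1).trans_eq ?_
      rw [← smul_add, hsum]
    · rw [hsplit _ (hQg.sub_right hQF)]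
      refine (add_le_add b1.2 b2.2).trans_eq ?_
      rw [← smul_add, hsum]

/-- An operator mean is given by the functional calculus of its representing function. -/
theorem opMean_one_eq_cfc : opMean σ 1 B = cfc (repFun σ) B := by
  have hsa := isSelfAdjoint_of_algebraMap_le hcB
  have hsp := spectrum_subset_Icc hcB hBC
  have hcC : c ≤ C := algebraMap_le_algebraMap_iff.1 (hcB.trans hBC)
  have hz : ∀ g : ℝ → ℝ, (∀ x ∈ Set.Icc c C, g x = 0) → cfc g B = 0 := fun g hg => by
    rw [cfc_congr (g := fun _ => (0 : ℝ)) fun x hx => hg x (hsp hx), cfc_const_zero]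
  -- R = 1 covers the whole interval [c, C]; the bound then tends to 0 as N grows.
  have hb := fun N : ℕ => hσ.projection_opMean_sub_cfc_bounds hc hcB hBC N le_rfl hcC le_rfl
    (IsStarProjection.one (H →L[ℂ] H)) (Commute.one_left B)
    (by rw [mul_one, hz]; intro x hx; exact max_eq_right (by linarith [hx.2]))
    (by rw [mul_one, hz]; intro x hx; exact max_eq_right (by linarith [hx.1]))
  simp only [one_mul, mul_one] at hb
  have hlim : Tendsto (fun N : ℕ => (repFun σ C / c * ((C - c) / 2 ^ N)) • (1 : H →L[ℂ] H)) atTop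
      (𝓝 0) := by
    have h1 : Tendsto (fun N : ℕ => (C - c) / 2 ^ N) atTop (𝓝 0) :=
      tendsto_const_nhds.div_atTop (tendsto_pow_atTop_atTop_of_one_lt one_lt_two)
    have h2 := (h1.const_mul (repFun σ C / c)).smul_const (1 : H →L[ℂ] H)
    simpa using h2
  refine le_antisymm (sub_nonpos.1 (ge_of_tendsto' hlim fun N => (hb N).1))
    (sub_nonpos.1 (ge_of_tendsto' hlim fun N => (hb N).2))

end

end IsOperatorMean

end FunctionalCalculus

/-! ### Strict monotonicity of the representing function -/

section StrictMonotonicity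

variable {H : Type*} [NormedAddCommGroup H] [InnerProductSpace ℂ H] [CompleteSpace H]

omit [CompleteSpace H] in
theorem nontrivial_of_not_finiteDimensional (hH : ¬ FiniteDimensional ℂ H) : Nontrivial H := by
  by_contra h
  rw [not_nontrivial_iff_subsingleton] at h
  exact hH inferInstance

omit [CompleteSpace H] in
theorem exists_orthonormal_pair (hH : ¬ FiniteDimensional ℂ H) :
    ∃ e f : H, ‖e‖ = 1 ∧ ‖f‖ = 1 ∧ inner ℂ e f = 0 := by
  have := nontrivial_of_not_finiteDimensional hH
  obtain ⟨e, he⟩ := exists_norm_eq H zero_le_one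
  have hne : (ℂ ∙ e)ᗮ ≠ ⊥ := by
    intro h
    rw [Submodule.orthogonal_eq_bot_iff] at h
    apply hH
    have : FiniteDimensional ℂ (⊤ : Submodule ℂ H) := h ▸ inferInstance
    exact Module.finite_def.2 (Module.Finite.iff_fg.1 this)
  obtain ⟨f, hf, hf0⟩ := (Submodule.ne_bot_iff _).1 hne
  have hef : inner ℂ e f = 0 := Submodule.mem_orthogonal_singleton_iff_inner_right.1 hf
  exact ⟨e, ((‖f‖⁻¹ : ℝ) : ℂ) • f, he, by rw [norm_smul]; simp [hf0], by simp [hef]⟩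

/-- The projections are onto two lines in one plane: Q onto e, and P onto e rotated by a small angle
θ. -/
theorem exists_close_projections (hH : ¬ FiniteDimensional ℂ H) {ε : ℝ} (hε : 0 < ε) :
    ∃ P Q : H →L[ℂ] H, IsStarProjection P ∧ IsStarProjection Q ∧ ‖Q - P‖ < ε ∧ P * Q ≠ Q := by
  obtain ⟨e, f, he, hf, hef⟩ := exists_orthonormal_pair hH
  set u : ℝ → H := fun θ => ((Real.cos θ : ℝ) : ℂ) • e + ((Real.sin θ : ℝ) : ℂ) • f with hu
  have hun : ∀ θ, ‖u θ‖ = 1 := by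
    intro θ
    have h1 : inner ℂ (((Real.cos θ : ℝ) : ℂ) • e) (((Real.sin θ : ℝ) : ℂ) • f) = 0 := by
      rw [inner_smul_left, inner_smul_right, hef, mul_zero, mul_zero]
    have h2 := norm_add_sq_eq_norm_sq_add_norm_sq_of_inner_eq_zero _ _ h1
    rw [norm_smul, norm_smul, he, hf, Complex.norm_real, Complex.norm_real, mul_one, mul_one,
      Real.norm_eq_abs, Real.norm_eq_abs, abs_mul_abs_self, abs_mul_abs_self] at h2
    have h3 := Real.cos_sq_add_sin_sq θ
    have h4 : ‖u θ‖ * ‖u θ‖ = 1 := by rw [h2]; linarith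
    nlinarith [norm_nonneg (u θ)]
  have hcont : Continuous u := by fun_prop
  have hu0 : u 0 = e := by simp [hu]
  obtain ⟨δ, hδ, hclose⟩ := Metric.continuousAt_iff.1 (hcont.continuousAt (x := 0)) (ε / 2)
    (by positivity)
  -- The bound θ ≤ 1 < π/2 keeps cos θ sin θ nonzero; this number is the f-component of PQe, while
  -- Qe = e has none.
  set θ := min (δ / 2) 1 with hθ
  have hθ0 : 0 < θ := by positivity
  have hθ1 : θ ≤ 1 := min_le_right _ _
  have hd : ‖u θ - e‖ < ε / 2 := by
    have := hclose (x := θ) (by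
      rw [dist_zero_right, Real.norm_eq_abs, abs_of_pos hθ0]
      exact (min_le_left _ _).trans_lt (by linarith))
    rwa [hu0, dist_eq_norm] at this
  refine ⟨InnerProductSpace.rankOne ℂ (u θ) (u θ), InnerProductSpace.rankOne ℂ e e,
    InnerProductSpace.isStarProjection_rankOne_self (hun θ),
    InnerProductSpace.isStarProjection_rankOne_self he, ?_, ?_⟩
  · have h1 : InnerProductSpace.rankOne ℂ e e - InnerProductSpace.rankOne ℂ (u θ) (u θ) =
        InnerProductSpace.rankOne ℂ (e - u θ) (u θ) + InnerProductSpace.rankOne ℂ e (e - u θ) := by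
      ext x
      simp only [sub_apply, add_apply,
        InnerProductSpace.rankOne_apply, inner_sub_left, sub_smul, smul_sub]
      abel
    rw [h1]
    refine (norm_add_le _ _).trans_lt ?_
    rw [InnerProductSpace.norm_rankOne, InnerProductSpace.norm_rankOne, hun, he, norm_sub_rev]
    linarith
  · intro h
    have h1 := congrArg (fun T : H →L[ℂ] H => inner ℂ f (T e)) h
    have hfe : inner ℂ f e = 0 := inner_eq_zero_symm.1 hef
    have he0 : e ≠ 0 := norm_ne_zero_iff.1 (by rw [he]; exact one_ne_zero)
    have hf0 : f ≠ 0 := norm_ne_zero_iff.1 (by rw [hf]; exact one_ne_zero)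
    have h2 : Real.cos θ * Real.sin θ ≠ 0 := by
      have hpi := Real.pi_gt_three
      exact mul_ne_zero (Real.cos_pos_of_mem_Ioo ⟨by linarith, by linarith⟩).ne'
        (Real.sin_pos_of_pos_of_lt_pi hθ0 (by linarith)).ne'
    simp [hu, hfe, he0, hf0] at h1
    apply h2
    rcases h1 with h1 | h1
    · rw [show Real.sin θ = 0 by exact_mod_cast h1, mul_zero]
    · rw [show Real.cos θ = 0 by exact_mod_cast h1, zero_mul]

/-- Compression by 1 - P kills the right side, leaving k(Q(1 - P))*(Q(1 - P)) ≤ 0. -/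
theorem IsStarProjection.mul_eq_right_of_smul_le {P Q : H →L[ℂ] H} (hP : IsStarProjection P)
    (hQ : IsStarProjection Q) {k l : ℝ} (hk : 0 < k) (h : k • Q ≤ l • P) : P * Q = Q := by
  have hPP : P * P = P := hP.isIdempotentElem
  have hQQ : Q * Q = Q := hQ.isIdempotentElem
  have h1 := conjugate_mono_of_isSelfAdjoint hP.one_sub.isSelfAdjoint h
  have h2 : (1 - P) * (l • P) * (1 - P) = 0 := by
    rw [mul_smul_comm, sub_mul, one_mul, hPP, sub_self, smul_zero, zero_mul]
  have h3 : (1 - P) * (k • Q) * (1 - P) = k • (star (Q * (1 - P)) * (Q * (1 - P))) := by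
    rw [star_mul, hQ.isSelfAdjoint.star_eq, hP.one_sub.isSelfAdjoint.star_eq, mul_smul_comm,
      smul_mul_assoc, mul_assoc (1 - P) Q (Q * _), ← mul_assoc Q Q, hQQ, ← mul_assoc]
  rw [h2, h3] at h1
  have h4 := le_antisymm h1 (smul_nonneg hk.le (star_mul_self_nonneg _))
  have h5 : Q * (1 - P) = 0 :=
    CStarRing.star_mul_self_eq_zero_iff _ |>.1 ((smul_eq_zero.1 h4).resolve_left hk.ne')
  have h6 := congrArg star h5
  rw [star_mul, star_zero, hQ.isSelfAdjoint.star_eq, hP.one_sub.isSelfAdjoint.star_eq, sub_mul,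
    one_mul] at h6
  exact (sub_eq_zero.1 h6).symm

namespace IsOperatorMean

variable {σ : PosOp H → PosOp H → PosOp H} (hσ : IsOperatorMean σ)
include hσ

theorem projection_opMean_one {P B : H →L[ℂ] H} (hP : IsStarProjection P) (hB : 0 ≤ B)
    (hPB : Commute P B) {r : ℝ} (hr : 0 ≤ r) (h : P * B * P = r • P) :
    P * opMean σ 1 B * P = repFun σ r • P := by
  have hPP : P * P = P := hP.isIdempotentElem
  have e1 : ∀ r : ℝ, P * algebraMap ℝ (H →L[ℂ] H) r * P = r • P := fun r => by
    rw [algebraMap_mul_comm_conj, hPP, Algebra.smul_def]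
  have e2 : ∀ X : H →L[ℂ] H, P * (P * X * P) * P = P * X * P := fun X => by
    simp only [← mul_assoc, hPP]
    simp only [mul_assoc, hPP]
  have hP1 : P * 1 * P ≤ 1 := by rw [mul_one, hPP]; exact hP.le_one
  have hr' := algebraMap_nonneg (H →L[ℂ] H) hr
  have h1 : P * B * P ≤ algebraMap ℝ (H →L[ℂ] H) r := by
    rw [h, Algebra.algebraMap_eq_smul_one]
    exact smul_le_smul_of_nonneg_left hP.le_one hr
  have h2 : P * algebraMap ℝ (H →L[ℂ] H) r * P ≤ B := by
    rw [e1, ← h]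
    exact projection_conjugate_le_of_commute hP hB hPB
  have h3 := conjugate_mono_of_isSelfAdjoint hP.isSelfAdjoint
    (hσ.projection_opMean_le hP zero_le_one hB hP1 h1)
  have h4 := conjugate_mono_of_isSelfAdjoint hP.isSelfAdjoint
    (hσ.projection_opMean_le hP zero_le_one hr' hP1 h2)
  rw [hσ.opMean_one_algebraMap hr, e1, e2] at h3
  rw [hσ.opMean_one_algebraMap hr, e1] at h4
  rw [mul_smul_comm, smul_mul_assoc, hPP, hPP] at h4
  exact le_antisymm h3 h4

theorem opMean_one_projection {P : H →L[ℂ] H} (hP : IsStarProjection P) {s t : ℝ} (hs : 0 ≤ s)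
    (ht : 0 ≤ t) : opMean σ 1 (s • P + t • (1 - P)) = repFun σ s • P + repFun σ t • (1 - P) := by
  have hPP : P * P = P := hP.isIdempotentElem
  have hQ := hP.one_sub
  set B := s • P + t • (1 - P) with hBdef
  have hB : 0 ≤ B := add_nonneg (smul_nonneg hs hP.nonneg) (smul_nonneg ht hQ.nonneg)
  have hc1 : Commute P (1 - P) := (Commute.one_right P).sub_right (Commute.refl P)
  have hPB : Commute P B := ((Commute.refl P).smul_right s).add_right (hc1.smul_right t)
  have hQB : Commute (1 - P) B := (Commute.one_left B).sub_left hPB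
  have h1 := hσ.projection_opMean_one hP hB hPB hs (by
    simp [hBdef, mul_add, mul_sub, hPP])
  have h2 := hσ.projection_opMean_one hQ hB hQB ht (by
    simp [hBdef, mul_add, mul_sub, sub_mul, hPP])
  have h3 := hσ.commute_opMean hP zero_le_one hB (Commute.one_right P) hPB
  rw [← h1, ← h2]
  have h4 : P * opMean σ 1 B * P = P * opMean σ 1 B := by rw [h3.eq, mul_assoc, hPP]
  simp only [mul_sub, sub_mul, one_mul, mul_one, h4, h3.eq.symm]
  abel

variable (hH : ¬ FiniteDimensional ℂ H)
include hH

/-- The increment of the arguments is (s - t)(Q - P) + (s' - s)Q + (t' - t)(1 - Q). The last two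
terms are at least δ, and for Q close to P the first is at least -δ; monotonicity of σ then applies
to this noncommuting pair. -/
theorem exists_projections_repFun_le {s s' t t' : ℝ} (hs : 0 ≤ s) (hss' : s < s') (ht : 0 ≤ t)
    (htt' : t < t') : ∃ P Q : H →L[ℂ] H, IsStarProjection P ∧ IsStarProjection Q ∧ P * Q ≠ Q ∧
      repFun σ s • P + repFun σ t • (1 - P) ≤ repFun σ s' • Q + repFun σ t' • (1 - Q) := by
  set δ := min (s' - s) (t' - t) with hδ
  have hδ0 : 0 < δ := lt_min (sub_pos.2 hss') (sub_pos.2 htt')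
  obtain ⟨P, Q, hP, hQ, hPQ, hne⟩ := exists_close_projections hH
    (ε := δ / (|s - t| + 1)) (by positivity)
  refine ⟨P, Q, hP, hQ, hne, ?_⟩
  rw [← hσ.opMean_one_projection hP hs ht,
    ← hσ.opMean_one_projection hQ (hs.trans hss'.le) (ht.trans htt'.le)]
  have h0 : 0 ≤ s • P + t • (1 - P) :=
    add_nonneg (smul_nonneg hs hP.nonneg) (smul_nonneg ht hP.one_sub.nonneg)
  suffices hle : s • P + t • (1 - P) ≤ s' • Q + t' • (1 - Q) from
    hσ.opMean_mono zero_le_one h0 le_rfl hle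
  have h1 : algebraMap ℝ (H →L[ℂ] H) (-δ) ≤ (s - t) • (Q - P) := by
    have hsa : IsSelfAdjoint ((s - t) • (Q - P)) :=
      IsSelfAdjoint.smul (IsSelfAdjoint.all (s - t)) (hQ.isSelfAdjoint.sub hP.isSelfAdjoint)
    rw [map_neg]
    refine (neg_le_neg (algebraMap_mono _ ?_)).trans hsa.neg_algebraMap_norm_le_self
    rw [norm_smul, Real.norm_eq_abs]
    have h2 := (lt_div_iff₀ (by positivity)).1 hPQ
    nlinarith [norm_nonneg (Q - P)]
  have h2 : algebraMap ℝ (H →L[ℂ] H) δ ≤ (s' - s) • Q + (t' - t) • (1 - Q) := by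
    rw [Algebra.algebraMap_eq_smul_one]
    have : δ • (1 : H →L[ℂ] H) = δ • Q + δ • (1 - Q) := by rw [← smul_add, add_sub_cancel]
    rw [this]
    exact add_le_add (smul_le_smul_of_nonneg_right (min_le_left _ _) hQ.nonneg)
      (smul_le_smul_of_nonneg_right (min_le_right _ _) hQ.one_sub.nonneg)
  rw [← sub_nonneg]
  have h3 := add_le_add h1 h2
  rw [← map_add, neg_add_cancel, map_zero] at h3
  refine h3.trans_eq ?_
  module

/-- Put the equal values f(a) = f(b) on one of the two spectral blocks. They cancel in the
inequality of `exists_projections_repFun_le`, and a value f(t) ≠ f(a) would leave a positive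
multiple of one projection below a multiple of the other, forcing PQ = Q. -/
theorem repFun_eq_of_eq {a b : ℝ} (ha : 0 < a) (hab : a < b) (h : repFun σ a = repFun σ b) {t : ℝ}
    (ht : 0 < t) : repFun σ t = repFun σ a := by
  have := nontrivial_of_not_finiteDimensional hH
  rcases lt_trichotomy t a with hta | rfl | hta
  · refine le_antisymm (hσ.repFun_mono ht.le hta.le) (not_lt.1 fun hlt => ?_)
    obtain ⟨P, Q, hP, hQ, hne, hle⟩ := hσ.exists_projections_repFun_le hH (s := t / 2) (s' := t)
      (by positivity) (by linarith) ha.le hab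
    rw [← h] at hle
    set m := repFun σ a
    refine hne (hP.mul_eq_right_of_smul_le hQ (sub_pos.2 hlt) (l := m - repFun σ (t / 2)) ?_)
    rw [← sub_nonneg] at hle ⊢
    refine hle.trans_eq ?_
    module
  · rfl
  · refine le_antisymm (not_lt.1 fun hlt => ?_) (hσ.repFun_mono ha.le hta.le)
    obtain ⟨P, Q, hP, hQ, hne, hle⟩ := hσ.exists_projections_repFun_le hH (t := t) (t' := t + 1)
      ha.le hab ht.le (by linarith)
    rw [← h] at hle
    set m := repFun σ a
    have h1 : (1 - Q) * (1 - P) = 1 - P := by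
      refine hQ.one_sub.mul_eq_right_of_smul_le hP.one_sub (sub_pos.2 hlt)
        (l := repFun σ (t + 1) - m) ?_
      rw [← sub_nonneg] at hle ⊢
      refine hle.trans_eq ?_
      module
    have h2 : Q * P = Q := by
      rw [sub_mul, one_mul, sub_eq_self, mul_sub, mul_one] at h1
      exact (sub_eq_zero.1 h1).symm
    have h3 := congrArg star h2
    rw [star_mul, hQ.isSelfAdjoint.star_eq, hP.isSelfAdjoint.star_eq] at h3
    exact hne h3

end IsOperatorMean

end StrictMonotonicity

/-! ### The mean of invertible operators -/

section Invertible

variable {H : Type*} [NormedAddCommGroup H] [InnerProductSpace ℂ H] [CompleteSpace H]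

theorem exists_algebraMap_bounds {A : H →L[ℂ] H} (hA : 0 ≤ A) (hAu : IsUnit A) :
    ∃ c C : ℝ, 0 < c ∧ algebraMap ℝ (H →L[ℂ] H) c ≤ A ∧ A ≤ algebraMap ℝ (H →L[ℂ] H) C := by
  have hs := IsSelfAdjoint.of_nonneg hA
  have hT : IsStrictlyPositive A := IsStrictlyPositive.iff_of_unital.2 ⟨hA, hAu⟩
  rcases subsingleton_or_nontrivial (H →L[ℂ] H) with h | h
  · exact ⟨1, 1, one_pos, (Subsingleton.elim _ _).le, (Subsingleton.elim _ _).le⟩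
  · obtain ⟨c, hc, hcA⟩ := (CFC.exists_pos_algebraMap_le_iff hT.isSelfAdjoint).2
      fun x hx => hT.spectrum_pos hx
    exact ⟨c, ‖A‖, hc, hcA, hs.le_algebraMap_norm_self⟩

/-- The inverse square root of a positive invertible operator. -/
noncomputable def invSqrt (A : H →L[ℂ] H) : H →L[ℂ] H :=
  cfc (fun x : ℝ => (√x)⁻¹) A

section

variable {A : H →L[ℂ] H} {c C : ℝ} (hc : 0 < c) (hcA : algebraMap ℝ (H →L[ℂ] H) c ≤ A)

theorem continuousOn_inv_sqrt {s : Set ℝ} (hs : ∀ x ∈ s, 0 < x) :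
    ContinuousOn (fun x : ℝ => (√x)⁻¹) s :=
  Real.continuous_sqrt.continuousOn.inv₀ fun x hx => (Real.sqrt_pos.2 (hs x hx)).ne'

theorem invSqrt_nonneg (A : H →L[ℂ] H) : 0 ≤ invSqrt A :=
  cfc_nonneg fun _ _ => inv_nonneg.2 (Real.sqrt_nonneg _)

include hc hcA

theorem spectrum_pos_of_algebraMap_le : ∀ x ∈ spectrum ℝ A, 0 < x := fun x hx =>
  hc.trans_le ((algebraMap_le_iff_le_spectrum (isSelfAdjoint_of_algebraMap_le hcA)).1 hcA x hx)

theorem cfc_sqrt_mul_self : cfc Real.sqrt A * cfc Real.sqrt A = A := by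
  have hsa := isSelfAdjoint_of_algebraMap_le hcA
  have hpos := spectrum_pos_of_algebraMap_le hc hcA
  rw [← cfc_mul _ _ A]
  conv_rhs => rw [← cfc_id ℝ A]
  exact cfc_congr fun x hx => Real.mul_self_sqrt (hpos x hx).le

theorem cfc_sqrt_mul_invSqrt : cfc Real.sqrt A * invSqrt A = 1 := by
  have hsa := isSelfAdjoint_of_algebraMap_le hcA
  have hpos := spectrum_pos_of_algebraMap_le hc hcA
  rw [invSqrt, ← cfc_mul _ _ A (by fun_prop) (continuousOn_inv_sqrt hpos), ← cfc_const_one ℝ A]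
  exact cfc_congr fun x hx => mul_inv_cancel₀ (Real.sqrt_pos.2 (hpos x hx)).ne'

theorem invSqrt_mul_cfc_sqrt : invSqrt A * cfc Real.sqrt A = 1 := by
  have h : Commute (invSqrt A) (cfc Real.sqrt A) := cfc_commute_cfc _ _ A
  rw [h.eq, cfc_sqrt_mul_invSqrt hc hcA]

theorem invSqrt_mul_self_le : invSqrt A * invSqrt A ≤ algebraMap ℝ (H →L[ℂ] H) c⁻¹ := by
  have hsa := isSelfAdjoint_of_algebraMap_le hcA
  have hpos := spectrum_pos_of_algebraMap_le hc hcA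
  rw [invSqrt, ← cfc_mul _ _ A (continuousOn_inv_sqrt hpos) (continuousOn_inv_sqrt hpos)]
  refine cfc_le_algebraMap _ _ _ (fun x hx => ?_)
    ((continuousOn_inv_sqrt hpos).mul (continuousOn_inv_sqrt hpos))
  rw [← mul_inv, Real.mul_self_sqrt (hpos x hx).le]
  exact inv_anti₀ hc ((algebraMap_le_iff_le_spectrum hsa).1 hcA x hx)

theorem le_invSqrt_mul_self (hAC : A ≤ algebraMap ℝ (H →L[ℂ] H) C) :
    algebraMap ℝ (H →L[ℂ] H) C⁻¹ ≤ invSqrt A * invSqrt A := by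
  have hsa := isSelfAdjoint_of_algebraMap_le hcA
  have hpos := spectrum_pos_of_algebraMap_le hc hcA
  rw [invSqrt, ← cfc_mul _ _ A (continuousOn_inv_sqrt hpos) (continuousOn_inv_sqrt hpos)]
  refine algebraMap_le_cfc _ _ _ (fun x hx => ?_)
    ((continuousOn_inv_sqrt hpos).mul (continuousOn_inv_sqrt hpos))
  rw [← mul_inv, Real.mul_self_sqrt (hpos x hx).le]
  exact inv_anti₀ (hpos x hx) ((le_algebraMap_iff_spectrum_le hsa).1 hAC x hx)

variable {B : H →L[ℂ] H} {d D : ℝ}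

theorem invSqrt_conjugate_le (hD : 0 ≤ D) (hBD : B ≤ algebraMap ℝ (H →L[ℂ] H) D) :
    invSqrt A * B * invSqrt A ≤ algebraMap ℝ (H →L[ℂ] H) (D * c⁻¹) := by
  have h := conjugate_mono_of_isSelfAdjoint (IsSelfAdjoint.of_nonneg (invSqrt_nonneg A)) hBD
  rw [algebraMap_mul_comm_conj, ← Algebra.smul_def] at h
  refine h.trans ((smul_le_smul_of_nonneg_left (invSqrt_mul_self_le hc hcA) hD).trans_eq ?_)
  rw [map_mul, Algebra.smul_def]

theorem le_invSqrt_conjugate (hAC : A ≤ algebraMap ℝ (H →L[ℂ] H) C) (hd : 0 ≤ d)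
    (hdB : algebraMap ℝ (H →L[ℂ] H) d ≤ B) :
    algebraMap ℝ (H →L[ℂ] H) (d * C⁻¹) ≤ invSqrt A * B * invSqrt A := by
  have h := conjugate_mono_of_isSelfAdjoint (IsSelfAdjoint.of_nonneg (invSqrt_nonneg A)) hdB
  rw [algebraMap_mul_comm_conj, ← Algebra.smul_def] at h
  refine le_trans ((smul_le_smul_of_nonneg_left (le_invSqrt_mul_self hc hcA hAC) hd).trans_eq' ?_) h
  rw [map_mul, Algebra.smul_def]

end

namespace IsOperatorMean

variable [Nontrivial H] {σ : PosOp H → PosOp H → PosOp H} (hσ : IsOperatorMean σ)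
include hσ

section

variable {A B : H →L[ℂ] H} {c C d D : ℝ} (hc : 0 < c)
  (hcA : algebraMap ℝ (H →L[ℂ] H) c ≤ A) (hAC : A ≤ algebraMap ℝ (H →L[ℂ] H) C) (hd : 0 < d)
  (hdB : algebraMap ℝ (H →L[ℂ] H) d ≤ B) (hBD : B ≤ algebraMap ℝ (H →L[ℂ] H) D)
include hc hcA hAC hd hdB hBD

theorem opMean_eq_conjugate_cfc : opMean σ A B =
    cfc Real.sqrt A * cfc (repFun σ) (invSqrt A * B * invSqrt A) * cfc Real.sqrt A := by
  have hC : 0 < C := hc.trans_le (algebraMap_le_algebraMap_iff.1 (hcA.trans hAC))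
  have hD : 0 < D := hd.trans_le (algebraMap_le_algebraMap_iff.1 (hdB.trans hBD))
  have hZ := le_invSqrt_conjugate hc hcA hAC hd.le hdB
  have hd' : 0 < d * C⁻¹ := by positivity
  have hr : 0 ≤ cfc Real.sqrt A := cfc_nonneg fun _ _ => Real.sqrt_nonneg _
  have hru : IsUnit (cfc Real.sqrt A) :=
    ⟨⟨_, _, cfc_sqrt_mul_invSqrt hc hcA, invSqrt_mul_cfc_sqrt hc hcA⟩, rfl⟩
  rw [← hσ.opMean_one_eq_cfc hd' hZ (invSqrt_conjugate_le hc hcA hD.le hBD),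
    hσ.opMean_conjugate zero_le_one (nonneg_of_algebraMap_le hd' hZ) hr hru, mul_one,
    cfc_sqrt_mul_self hc hcA]
  congr 1
  simp only [← mul_assoc, cfc_sqrt_mul_invSqrt hc hcA, one_mul]
  rw [mul_assoc, invSqrt_mul_cfc_sqrt hc hcA, mul_one]

/-- Shrinking the second argument of a strictly monotone mean gains a factor below one. -/
theorem exists_opMean_le_mul (hf : StrictMonoOn (repFun σ) (Set.Ioi 0)) {l : ℝ} (hl0 : 0 < l)
    (hl1 : l < 1) : ∃ ρ : ℝ, 0 < ρ ∧ ρ < 1 ∧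
      opMean σ A (algebraMap ℝ (H →L[ℂ] H) l * B) ≤ algebraMap ℝ (H →L[ℂ] H) ρ * opMean σ A B := by
  have hC : 0 < C := hc.trans_le (algebraMap_le_algebraMap_iff.1 (hcA.trans hAC))
  have hD : 0 < D := hd.trans_le (algebraMap_le_algebraMap_iff.1 (hdB.trans hBD))
  set Z := invSqrt A * B * invSqrt A with hZdef
  have hZ := le_invSqrt_conjugate hc hcA hAC hd.le hdB
  have hZ' := invSqrt_conjugate_le hc hcA hD.le hBD
  set a := d * C⁻¹ with ha
  set b := D * c⁻¹ with hb
  have ha0 : 0 < a := by positivity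
  have hab : a ≤ b := algebraMap_le_algebraMap_iff.1 (hZ.trans hZ')
  have hsa := isSelfAdjoint_of_algebraMap_le hZ
  have hsp : spectrum ℝ Z ⊆ Set.Icc a b := spectrum_subset_Icc hZ hZ'
  have hcont := hσ.continuousOn_repFun (C := b) ha0
  have hcont' : ContinuousOn (fun x => repFun σ (l * x)) (Set.Icc a b) :=
    (hσ.continuousOn_repFun (c := l * a) (C := l * b) (by positivity)).comp (by fun_prop)
      fun x hx => ⟨by gcongr; exact hx.1, by gcongr; exact hx.2⟩
  have hpos : ∀ x ∈ Set.Icc a b, 0 < repFun σ x := fun x hx =>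
    hσ.repFun_pos (ha0.trans_le hx.1)
  -- The factor ρ is the maximum of f(lx)/f(x) over [a, b], an interval containing the spectrum of
  -- Z; being attained, it is strictly below 1.
  obtain ⟨x₀, hx₀, hmax⟩ := isCompact_Icc.exists_isMaxOn (Set.nonempty_Icc.2 hab)
    (hcont'.div hcont fun x hx => (hpos x hx).ne')
  have hx₀0 : 0 < x₀ := ha0.trans_le hx₀.1
  refine ⟨repFun σ (l * x₀) / repFun σ x₀,
    div_pos (hσ.repFun_pos (by positivity)) (hpos _ hx₀), ?_, ?_⟩
  · rw [div_lt_one (hpos _ hx₀)]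
    exact hf (Set.mem_Ioi.2 (by positivity)) hx₀0 (by nlinarith)
  set ρ := repFun σ (l * x₀) / repFun σ x₀ with hρ
  have hldB : algebraMap ℝ (H →L[ℂ] H) (l * d) ≤ algebraMap ℝ (H →L[ℂ] H) l * B := by
    rw [map_mul, ← Algebra.smul_def, ← Algebra.smul_def]
    exact smul_le_smul_of_nonneg_left hdB hl0.le
  have hlBD : algebraMap ℝ (H →L[ℂ] H) l * B ≤ algebraMap ℝ (H →L[ℂ] H) (l * D) := by
    rw [map_mul, ← Algebra.smul_def, ← Algebra.smul_def]
    exact smul_le_smul_of_nonneg_left hBD hl0.le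
  have hZl : invSqrt A * (algebraMap ℝ (H →L[ℂ] H) l * B) * invSqrt A = l • Z := by
    rw [← Algebra.smul_def, mul_smul_comm, smul_mul_assoc]
  have hkey : cfc (repFun σ) (l • Z) ≤ ρ • cfc (repFun σ) Z := by
    rw [← cfc_comp_const_mul l (repFun σ) Z ?_, ← cfc_smul _ _ Z (hcont.mono hsp)]
    · refine cfc_mono (fun x hx => ?_) (hcont'.mono hsp) ((hcont.mono hsp).const_smul ρ)
      have h1 : repFun σ (l * x) / repFun σ x ≤ ρ := hmax (hsp hx)
      exact (div_le_iff₀ (hpos x (hsp hx))).1 h1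
    · refine (hσ.continuousOn_repFun (c := l * a) (C := l * b) (by positivity)).mono ?_
      rintro _ ⟨x, hx, rfl⟩
      exact ⟨by dsimp only; gcongr; exact (hsp hx).1, by dsimp only; gcongr; exact (hsp hx).2⟩
  rw [hσ.opMean_eq_conjugate_cfc hc hcA hAC (mul_pos hl0 hd) hldB hlBD, hZl,
    hσ.opMean_eq_conjugate_cfc hc hcA hAC hd hdB hBD, ← Algebra.smul_def]
  have h := conjugate_mono_of_isSelfAdjoint (C := cfc Real.sqrt A) (cfc_predicate _ _) hkey
  rwa [mul_smul_comm, smul_mul_assoc] at h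

end

/-- Each ingredient of the formula for A σ B is strongly continuous under uniform bounds. No
monotonicity in k is needed, so increasing sequences are covered as well. -/
theorem sotTendsto_opMean {A B : ℕ → H →L[ℂ] H} {A' B' : H →L[ℂ] H} {c C d D : ℝ} (hc : 0 < c)
    (hd : 0 < d) (hcA : ∀ k, algebraMap ℝ (H →L[ℂ] H) c ≤ A k)
    (hAC : ∀ k, A k ≤ algebraMap ℝ (H →L[ℂ] H) C)
    (hdB : ∀ k, algebraMap ℝ (H →L[ℂ] H) d ≤ B k)
    (hBD : ∀ k, B k ≤ algebraMap ℝ (H →L[ℂ] H) D) (hA : SOTTendsto A A') (hB : SOTTendsto B B') :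
    SOTTendsto (fun k => opMean σ (A k) (B k)) (opMean σ A' B') := by
  have hC : 0 < C := hc.trans_le (algebraMap_le_algebraMap_iff.1 ((hcA 0).trans (hAC 0)))
  have hD : 0 < D := hd.trans_le (algebraMap_le_algebraMap_iff.1 ((hdB 0).trans (hBD 0)))
  have hsqrt := hA.cfc hcA hAC Real.continuous_sqrt.continuousOn
  have hinv : SOTTendsto (fun k => invSqrt (A k)) (invSqrt A') :=
    hA.cfc hcA hAC (continuousOn_inv_sqrt fun x hx => hc.trans_le hx.1)
  have hZ := ((hinv.mul hB).mul hinv).cfc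
    (fun k => le_invSqrt_conjugate hc (hcA k) (hAC k) hd.le (hdB k))
    (fun k => invSqrt_conjugate_le hc (hcA k) hD.le (hBD k))
    (hσ.continuousOn_repFun (by positivity))
  rw [hσ.opMean_eq_conjugate_cfc hc ((SOTTendsto.const _).le hA hcA)
    (hA.le (SOTTendsto.const _) hAC) hd ((SOTTendsto.const _).le hB hdB)
    (hB.le (SOTTendsto.const _) hBD)]
  have h := (hsqrt.mul hZ).mul hsqrt
  intro x
  refine (h x).congr fun k => ?_
  dsimp only
  rw [hσ.opMean_eq_conjugate_cfc hc (hcA k) (hAC k) hd (hdB k) (hBD k)]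

theorem opMean_one_unitary_conjugate {B : H →L[ℂ] H} (hB : 0 ≤ B) (hBu : IsUnit B)
    (U : unitary (H →L[ℂ] H)) :
    opMean σ 1 (star (U : H →L[ℂ] H) * B * U) = star (U : H →L[ℂ] H) * opMean σ 1 B * U := by
  obtain ⟨c, C, hc, hcB, hBC⟩ := exists_algebraMap_bounds hB hBu
  have hUU : star (U : H →L[ℂ] H) * U = 1 := Unitary.coe_star_mul_self U
  have hscal : ∀ r : ℝ, star (U : H →L[ℂ] H) * algebraMap ℝ (H →L[ℂ] H) r * U =
      algebraMap ℝ (H →L[ℂ] H) r := fun r => by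
    rw [← Algebra.commutes, mul_assoc, hUU, mul_one]
  have h1 := star_left_conjugate_le_conjugate hcB (U : H →L[ℂ] H)
  have h2 := star_left_conjugate_le_conjugate hBC (U : H →L[ℂ] H)
  rw [hscal] at h1 h2
  have hsa := isSelfAdjoint_of_algebraMap_le hcB
  rw [hσ.opMean_one_eq_cfc hc h1 h2, hσ.opMean_one_eq_cfc hc hcB hBC]
  have h3 : ∀ X : H →L[ℂ] H, Unitary.conjStarAlgAut ℂ (H →L[ℂ] H) (star U) X =
      star (U : H →L[ℂ] H) * X * U := fun X => by simp
  have h4 : Continuous (Unitary.conjStarAlgAut ℂ (H →L[ℂ] H) (star U)) := by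
    rw [show ⇑(Unitary.conjStarAlgAut ℂ (H →L[ℂ] H) (star U)) = _ from funext h3]
    fun_prop
  rw [← h3, ← h3]
  refine (StarAlgHomClass.map_cfc (S := ℂ) (Unitary.conjStarAlgAut ℂ (H →L[ℂ] H) (star U))
    (repFun σ) B ((hσ.continuousOn_repFun hc).mono (spectrum_subset_Icc hcB hBC)) h4 hsa ?_).symm
  rw [h3]
  exact isSelfAdjoint_of_algebraMap_le h1

/-- Polar decomposition: with A = R² and T = (S*AS)^{1/2}, the operator V = RST⁻¹ is unitary and RS
= VT. Congruence by S thus reduces to positive conjugations by R and T and a unitary one by V. -/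
theorem opMean_congruence {A B : H →L[ℂ] H} (hA : 0 ≤ A) (hAu : IsUnit A) (hB : 0 ≤ B)
    (hBu : IsUnit B) (S : (H →L[ℂ] H)ˣ) :
    opMean σ (star (S : H →L[ℂ] H) * A * S) (star (S : H →L[ℂ] H) * B * S) =
      star (S : H →L[ℂ] H) * opMean σ A B * S := by
  have hroot : ∀ X : H →L[ℂ] H, 0 ≤ X → IsUnit X →
      ∃ R : (H →L[ℂ] H)ˣ, 0 ≤ (R : H →L[ℂ] H) ∧ (R : H →L[ℂ] H) * R = X := by
    intro X hX hXu
    obtain ⟨c, C, hc, hcX, hXC⟩ := exists_algebraMap_bounds hX hXu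
    exact ⟨⟨_, _, cfc_sqrt_mul_invSqrt hc hcX, invSqrt_mul_cfc_sqrt hc hcX⟩,
      cfc_nonneg fun _ _ => Real.sqrt_nonneg _, cfc_sqrt_mul_self hc hcX⟩
  obtain ⟨R, hR, rfl⟩ := hroot A hA hAu
  obtain ⟨T, hT, hTT⟩ := hroot (star (S : H →L[ℂ] H) * (R * R) * S)
    (star_left_conjugate_nonneg hA _) ((S.isUnit.star.mul hAu).mul S.isUnit)
  have hRs : star R = R := Units.ext (IsSelfAdjoint.of_nonneg hR).star_eq
  have hTs : star T = T := Units.ext (IsSelfAdjoint.of_nonneg hT).star_eq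
  have hTT' : T * T = star S * (R * R) * S := Units.ext hTT
  have hU : star (R * S * T⁻¹) * (R * S * T⁻¹) = 1 := by
    rw [star_mul, star_mul, star_inv, hRs, hTs]
    have : T⁻¹ * (star S * R) * (R * S * T⁻¹) = T⁻¹ * (star S * (R * R) * S) * T⁻¹ := by group
    rw [this, ← hTT']
    group
  set V : (H →L[ℂ] H)ˣ := R * S * T⁻¹ with hV
  have hU' : V * star V = 1 := by
    rw [← inv_eq_of_mul_eq_one_left hU, mul_inv_cancel]
  let U : unitary (H →L[ℂ] H) := ⟨V, Unitary.mem_iff.2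
    ⟨congrArg Units.val hU, congrArg Units.val hU'⟩⟩
  set Z : H →L[ℂ] H := (R⁻¹ : (H →L[ℂ] H)ˣ) * B * (R⁻¹ : (H →L[ℂ] H)ˣ) with hZ
  have hRi := units_inv_nonneg_of_nonneg R hR
  have hZ0 : 0 ≤ Z := by
    simpa using conjugate_mono_of_isSelfAdjoint (IsSelfAdjoint.of_nonneg hRi) hB
  have hZu : IsUnit Z := ((R⁻¹).isUnit.mul hBu).mul (R⁻¹).isUnit
  have hB' : (R : H →L[ℂ] H) * Z * R = B := by simp [hZ, mul_assoc]
  have hSV : R * S = V * T := by rw [hV]; group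
  have hSV' : (R : H →L[ℂ] H) * S = V * T := congrArg Units.val hSV
  have hSV'' : star (S : H →L[ℂ] H) * R = T * star (V : H →L[ℂ] H) := by
    have := congrArg star hSV'
    rwa [star_mul, star_mul, (IsSelfAdjoint.of_nonneg hR).star_eq,
      (IsSelfAdjoint.of_nonneg hT).star_eq] at this
  have hconj : ∀ X : H →L[ℂ] H, star (S : H →L[ℂ] H) * (R * X * R) * S =
      T * (star (V : H →L[ℂ] H) * X * V) * T := by
    intro X
    calc star (S : H →L[ℂ] H) * (R * X * R) * S = (star (S : H →L[ℂ] H) * R) * X * (R * S) := by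
          simp only [mul_assoc]
      _ = _ := by rw [hSV', hSV'']; simp only [mul_assoc]
  have e1 : opMean σ (R * R) B = R * opMean σ 1 Z * R := by
    rw [hσ.opMean_conjugate zero_le_one hZ0 hR R.isUnit, mul_one, hB']
  rw [e1, hconj, ← hTT, ← hB', hconj]
  have e2 := hσ.opMean_one_unitary_conjugate hZ0 hZu U
  change opMean σ 1 (star (V : H →L[ℂ] H) * Z * V) = star (V : H →L[ℂ] H) * opMean σ 1 Z * V at e2
  rw [← e2, hσ.opMean_conjugate zero_le_one (star_left_conjugate_nonneg hZ0 _) hT T.isUnit, mul_one]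

/-- The formula settles invertible arguments; adding ε k ↓ 0 to both arguments and using downward
continuity extends the identity to all of B(H)⁺. -/
theorem eq_left_of_repFun_eq_one (hf : ∀ t, 0 < t → repFun σ t = 1) : σ = fun A _ => A := by
  have hinv : ∀ (A B : H →L[ℂ] H) (c C d D : ℝ), 0 < c → 0 < d →
      algebraMap ℝ (H →L[ℂ] H) c ≤ A → A ≤ algebraMap ℝ (H →L[ℂ] H) C →
      algebraMap ℝ (H →L[ℂ] H) d ≤ B → B ≤ algebraMap ℝ (H →L[ℂ] H) D → opMean σ A B = A := by
    intro A B c C d D hc hd hcA hAC hdB hBD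
    have hC : 0 < C := hc.trans_le (algebraMap_le_algebraMap_iff.1 (hcA.trans hAC))
    have hZ := le_invSqrt_conjugate hc hcA hAC hd.le hdB
    have hsa := isSelfAdjoint_of_algebraMap_le hZ
    rw [hσ.opMean_eq_conjugate_cfc hc hcA hAC hd hdB hBD,
      cfc_congr (g := fun _ => (1 : ℝ)) fun x hx =>
        hf x (spectrum_pos_of_algebraMap_le (by positivity) hZ x hx),
      cfc_const_one ℝ _ hsa, mul_one, cfc_sqrt_mul_self hc hcA]
  funext A B
  let ε : ℕ → ℝ := fun k => 1 / ((k : ℝ) + 1)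
  have hε : ∀ k, 0 < ε k := fun k => Nat.one_div_pos_of_nat
  let shift : PosOp H → ℕ → PosOp H := fun X k =>
    ⟨X.1 + algebraMap ℝ (H →L[ℂ] H) (ε k), add_nonneg X.2 (algebraMap_nonneg _ (hε k).le)⟩
  have hanti : ∀ X, Antitone (shift X) := fun X k m hkm => by
    change X.1 + _ ≤ X.1 + _
    exact add_le_add le_rfl (algebraMap_mono _ (Nat.one_div_le_one_div hkm))
  have hlim : ∀ X, SOTTendsto (fun k => (shift X k).1) X.1 := fun X x => by
    have h1 : Tendsto ε atTop (𝓝 0) := tendsto_one_div_add_atTop_nhds_zero_nat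
    have h2 := (h1.smul_const x).const_add (X.1 x)
    rw [zero_smul, add_zero] at h2
    refine h2.congr fun k => ?_
    simp [shift, Algebra.algebraMap_eq_smul_one]
  have hbd : ∀ (X : PosOp H) (k : ℕ), algebraMap ℝ (H →L[ℂ] H) (ε k) ≤ (shift X k).1 ∧
      (shift X k).1 ≤ algebraMap ℝ (H →L[ℂ] H) (‖X.1‖ + ε k) := fun X k =>
    ⟨le_add_of_nonneg_left X.2, by
      rw [map_add]
      exact add_le_add (IsSelfAdjoint.of_nonneg X.2).le_algebraMap_norm_self le_rfl⟩
  have h := (hσ.downward (shift A) (shift B) A B (hanti A) (hlim A) (hanti B) (hlim B)).2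
  refine Subtype.ext (h.unique fun x => ((hlim A) x).congr fun k => ?_)
  dsimp only
  rw [← opMean_coe, hinv _ _ _ _ _ _ (hε k) (hε k) (hbd A k).1 (hbd A k).2 (hbd B k).1 (hbd B k).2]

omit [Nontrivial H] in
theorem strictMonoOn_repFun (hH : ¬ FiniteDimensional ℂ H) (hσl : σ ≠ fun A _ => A) :
    StrictMonoOn (repFun σ) (Set.Ioi 0) := by
  have := nontrivial_of_not_finiteDimensional hH
  intro a ha b hb hab
  refine lt_of_le_of_ne (hσ.repFun_mono (le_of_lt ha) hab.le) fun h => hσl ?_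
  refine hσ.eq_left_of_repFun_eq_one fun t ht => ?_
  rw [hσ.repFun_eq_of_eq hH ha hab h ht, ← hσ.repFun_eq_of_eq hH ha hab h one_pos, hσ.repFun_one]

end IsOperatorMean

end Invertible

/-! ### Fixed points of the deformed map -/

section FixedPoint

variable {H : Type*} [NormedAddCommGroup H] [InnerProductSpace ℂ H] [CompleteSpace H]

namespace PosInv

theorem exists_bounds (A : PosInv H) :
    ∃ c C : ℝ, 0 < c ∧ algebraMap ℝ (H →L[ℂ] H) c ≤ A.1 ∧ A.1 ≤ algebraMap ℝ (H →L[ℂ] H) C :=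
  exists_algebraMap_bounds A.2.1 A.2.2

/-- A positive multiple of the identity. -/
noncomputable def scalar (H : Type*) [NormedAddCommGroup H] [InnerProductSpace ℂ H]
    [CompleteSpace H] (r : ℝ) (hr : 0 < r) : PosInv H :=
  ⟨algebraMap ℝ (H →L[ℂ] H) r, algebraMap_nonneg _ hr.le, hr.ne'.isUnit.map _⟩

/-- The operator of multiplication by `√r`. -/
noncomputable def sqrtUnit (H : Type*) [NormedAddCommGroup H] [InnerProductSpace ℂ H]
    [CompleteSpace H] (r : ℝ) (hr : 0 < r) : (H →L[ℂ] H)ˣ :=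
  Units.map (algebraMap ℝ (H →L[ℂ] H)).toMonoidHom (Units.mk0 √r (Real.sqrt_pos.2 hr).ne')

/-- Turns congruence invariance of M and σ into positive homogeneity. -/
theorem congr_sqrtUnit_val (A : PosInv H) {r : ℝ} (hr : 0 < r) :
    (congr (sqrtUnit H r hr) A).1 = algebraMap ℝ (H →L[ℂ] H) r * A.1 := by
  change star (algebraMap ℝ (H →L[ℂ] H) √r) * A.1 * algebraMap ℝ (H →L[ℂ] H) √r = _
  rw [(IsSelfAdjoint.algebraMap _ (.all √r)).star_eq, mul_assoc, ← Algebra.commutes, ← mul_assoc,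
    ← map_mul, Real.mul_self_sqrt hr.le]

theorem congr_sqrtUnit_id {r : ℝ} (hr : 0 < r) :
    congr (sqrtUnit H r hr) (id H) = scalar H r hr := by
  apply Subtype.ext
  rw [congr_sqrtUnit_val]
  exact mul_one _

theorem exists_uniform_bounds {X : ℕ → PosInv H} {T : PosInv H} (hX : Antitone X ∨ Monotone X)
    (hT : SOTTendsto (fun k => (X k).1) T.1) :
    ∃ c C : ℝ, 0 < c ∧ (∀ k, algebraMap ℝ (H →L[ℂ] H) c ≤ (X k).1) ∧
      ∀ k, (X k).1 ≤ algebraMap ℝ (H →L[ℂ] H) C := by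
  obtain ⟨c, C, hc, h1, h2⟩ := T.exists_bounds
  obtain ⟨d, D, hd, h3, h4⟩ := (X 0).exists_bounds
  rcases hX with hX | hX
  · exact ⟨c, D, hc, fun k => h1.trans (hT.le_of_antitone (fun _ _ h => hX h) k),
      fun k => (show (X k).1 ≤ (X 0).1 from hX (Nat.zero_le k)).trans h4⟩
  · exact ⟨d, C, hd, fun k => h3.trans (show (X 0).1 ≤ (X k).1 from hX (Nat.zero_le k)),
      fun k => (hT.ge_of_monotone (fun _ _ h => hX h) k).trans h2⟩

theorem exists_sotTendsto {X : ℕ → PosInv H} {P Q : PosInv H} (hX : Antitone X ∨ Monotone X)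
    (hP : ∀ k, P ≤ X k) (hQ : ∀ k, X k ≤ Q) :
    ∃ T : PosInv H, SOTTendsto (fun k => (X k).1) T.1 := by
  have key : ∃ T : H →L[ℂ] H, SOTTendsto (fun k => (X k).1) T := by
    rcases hX with hX | hX
    · exact exists_sotTendsto_of_antitone (fun _ _ h => hX h) fun k => (X k).2.1
    -- An increasing sequence bounded by Q is treated through the decreasing sequence Q - X k.
    · obtain ⟨T, hT⟩ := exists_sotTendsto_of_antitone (T := fun k => Q.1 - (X k).1)
        (fun _ _ h => sub_le_sub_left (show (X _).1 ≤ (X _).1 from hX h) _)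
        fun k => sub_nonneg.2 (hQ k)
      exact ⟨Q.1 - T, by simpa using (SOTTendsto.const Q.1).sub hT⟩
  obtain ⟨T, hT⟩ := key
  obtain ⟨c, C, hc, h1, -⟩ := P.exists_bounds
  have h2 : algebraMap ℝ (H →L[ℂ] H) c ≤ T :=
    h1.trans ((SOTTendsto.const P.1).le hT fun k => hP k)
  exact ⟨⟨T, nonneg_of_algebraMap_le hc h2, isUnit_of_algebraMap_le hc h2⟩, hT⟩

end PosInv

variable {σ : PosOp H → PosOp H → PosOp H} (hσ : IsOperatorMean σ)

namespace IsOperatorMean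

theorem onPosInv_val (A B : PosInv H) : (hσ.onPosInv A B).1 = opMean σ A.1 B.1 :=
  (opMean_coe σ A.toPosOp B.toPosOp).symm

theorem onPosInv_mono {A B C D : PosInv H} (hAC : A ≤ C) (hBD : B ≤ D) :
    hσ.onPosInv A B ≤ hσ.onPosInv C D :=
  hσ.monotone A.toPosOp B.toPosOp C.toPosOp D.toPosOp hAC hBD

theorem onPosInv_congr [Nontrivial H] (A B : PosInv H) (S : (H →L[ℂ] H)ˣ) :
    hσ.onPosInv (PosInv.congr S A) (PosInv.congr S B) = PosInv.congr S (hσ.onPosInv A B) := by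
  apply Subtype.ext
  rw [onPosInv_val]
  refine (hσ.opMean_congruence A.2.1 A.2.2 B.2.1 B.2.2 S).trans ?_
  rw [← hσ.onPosInv_val]
  rfl

theorem onPosInv_id : hσ.onPosInv (PosInv.id H) (PosInv.id H) = PosInv.id H :=
  Subtype.ext ((hσ.onPosInv_val _ _).trans hσ.opMean_one_one)

theorem onPosInv_scalar [Nontrivial H] {r : ℝ} (hr : 0 < r) :
    hσ.onPosInv (PosInv.scalar H r hr) (PosInv.scalar H r hr) = PosInv.scalar H r hr := by
  rw [← PosInv.congr_sqrtUnit_id, hσ.onPosInv_congr, hσ.onPosInv_id]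

end IsOperatorMean

variable {n : ℕ} {M : (Fin n → PosInv H) → PosInv H} (hM : IsMultivariateMean M)

/-- The map `X ↦ M (X σ A₁, …, X σ Aₙ)`. -/
noncomputable def deformedMap (M : (Fin n → PosInv H) → PosInv H) (A : Fin n → PosInv H)
    (X : PosInv H) : PosInv H :=
  M fun j => hσ.onPosInv X (A j)

include hM

theorem IsMultivariateMean.apply_scalar {r : ℝ} (hr : 0 < r) :
    M (fun _ => PosInv.scalar H r hr) = PosInv.scalar H r hr := by
  rw [← PosInv.congr_sqrtUnit_id, ← hM.congruence, hM.normalized]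

theorem deformedMap_mono {A B : Fin n → PosInv H} {X Y : PosInv H} (hAB : ∀ j, A j ≤ B j)
    (hXY : X ≤ Y) : deformedMap hσ M A X ≤ deformedMap hσ M B Y :=
  hM.monotone _ _ fun j => hσ.onPosInv_mono hXY (hAB j)

section Nontrivial

variable [Nontrivial H]

theorem deformedMap_scalar {r : ℝ} (hr : 0 < r) :
    deformedMap hσ M (fun _ => PosInv.scalar H r hr) (PosInv.scalar H r hr) =
      PosInv.scalar H r hr := by
  simp only [deformedMap, hσ.onPosInv_scalar, hM.apply_scalar]

theorem deformedMap_congr (A : Fin n → PosInv H) (X : PosInv H) (S : (H →L[ℂ] H)ˣ) :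
    deformedMap hσ M (fun j => PosInv.congr S (A j)) (PosInv.congr S X) =
      PosInv.congr S (deformedMap hσ M A X) := by
  simp only [deformedMap, hσ.onPosInv_congr, hM.congruence]

theorem sotTendsto_deformedMap {A : Fin n → ℕ → PosInv H} {L : Fin n → PosInv H} {X : ℕ → PosInv H}
    {T : PosInv H} (hmono : ((∀ j, Antitone (A j)) ∧ Antitone X) ∨
      ((∀ j, Monotone (A j)) ∧ Monotone X))
    (hL : ∀ j, SOTTendsto (fun k => (A j k).1) (L j).1) (hT : SOTTendsto (fun k => (X k).1) T.1) :
    SOTTendsto (fun k => (deformedMap hσ M (fun j => A j k) (X k)).1)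
      (deformedMap hσ M L T).1 := by
  refine hM.continuity (fun j k => hσ.onPosInv (X k) (A j k)) _ ?_ fun j => ?_
  · rcases hmono with ⟨h1, h2⟩ | ⟨h1, h2⟩
    · exact Or.inl fun j _ _ hkm => hσ.onPosInv_mono (h2 hkm) (h1 j hkm)
    · exact Or.inr fun j _ _ hkm => hσ.onPosInv_mono (h2 hkm) (h1 j hkm)
  · have hA : Antitone (A j) ∨ Monotone (A j) := hmono.imp (fun h => h.1 j) fun h => h.1 j
    have hX : Antitone X ∨ Monotone X := hmono.imp And.right And.right
    obtain ⟨d, D, hd, hd1, hd2⟩ := PosInv.exists_uniform_bounds hA (hL j)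
    obtain ⟨c, C, hc, hc1, hc2⟩ := PosInv.exists_uniform_bounds hX hT
    simp only [hσ.onPosInv_val]
    exact hσ.sotTendsto_opMean hc hd hc1 hc2 hd1 hd2 hT (hL j)

/-- The fixed point is the strong limit of the decreasing iterates of F at Y. Any Z ≤ Y with Z ≤
F(Z) stays below every iterate, hence below the limit. -/
theorem exists_fixedPoint_le {A : Fin n → PosInv H} {Y : PosInv H} (hY : deformedMap hσ M A Y ≤ Y) :
    ∃ X, X = deformedMap hσ M A X ∧ X ≤ Y ∧ ∀ Z, Z ≤ deformedMap hσ M A Z → Z ≤ Y → Z ≤ X := by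
  set F := deformedMap hσ M A with hF
  have hFmono : Monotone F := fun _ _ h => deformedMap_mono hσ hM (fun _ => le_rfl) h
  set X : ℕ → PosInv H := fun k => F^[k] Y with hX
  have hsucc : ∀ k, X (k + 1) = F (X k) := fun k => Function.iterate_succ_apply' F k Y
  have hanti : Antitone X := hFmono.antitone_iterate_of_map_le hY
  have hlow : ∀ Z, Z ≤ F Z → Z ≤ Y → ∀ k, Z ≤ X k := by
    intro Z hZ hZY k
    induction k with
    | zero => exact hZY
    | succ k ih => rw [hsucc]; exact hZ.trans (hFmono ih)
  -- A scalar r below Y and all A j satisfies r ≤ F(r), so it bounds the iterates from below and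
  -- keeps the limit invertible.
  have hscalar : ∃ (r : ℝ) (hr : 0 < r), PosInv.scalar H r hr ≤ Y ∧
      ∀ j, PosInv.scalar H r hr ≤ A j := by
    obtain ⟨c, -, hc, hcY, -⟩ := Y.exists_bounds
    choose d _ hd hdA _ using fun j => (A j).exists_bounds
    have h1 : ∀ᶠ r in 𝓝[>] (0 : ℝ), r ≤ c := by
      filter_upwards [Ioo_mem_nhdsGT hc] with r hr using hr.2.le
    have h2 : ∀ᶠ r in 𝓝[>] (0 : ℝ), ∀ j, r ≤ d j := eventually_all.2 fun j => by
      filter_upwards [Ioo_mem_nhdsGT (hd j)] with r hr using hr.2.le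
    have h0 : ∀ᶠ r in 𝓝[>] (0 : ℝ), 0 < r := self_mem_nhdsWithin
    obtain ⟨r, hr, hr1, hr2⟩ := (h0.and (h1.and h2)).exists
    exact ⟨r, hr, (algebraMap_mono _ hr1).trans hcY, fun j => (algebraMap_mono _ (hr2 j)).trans (hdA j)⟩
  obtain ⟨r, hr, hrY, hrA⟩ := hscalar
  have hrF : PosInv.scalar H r hr ≤ F (PosInv.scalar H r hr) :=
    (deformedMap_scalar hσ hM hr).symm.le.trans (deformedMap_mono hσ hM hrA le_rfl)
  obtain ⟨T, hT⟩ := PosInv.exists_sotTendsto (Or.inl hanti) (hlow _ hrF hrY)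
    fun k => hanti (Nat.zero_le k)
  refine ⟨T, ?_, hT.le_of_antitone (fun _ _ h => hanti h) 0, fun Z hZ hZY =>
    (SOTTendsto.const Z.1).le hT fun k => hlow Z hZ hZY k⟩
  have h1 := sotTendsto_deformedMap hσ hM (A := fun j _ => A j) (L := A)
    (Or.inl ⟨fun j => antitone_const, hanti⟩) (fun j => SOTTendsto.const _) hT
  have h2 : SOTTendsto (fun k => (X (k + 1)).1) T.1 := hT.comp (tendsto_add_atTop_nat 1)
  refine Subtype.ext (h2.unique ?_)
  simp only [hsucc]
  exact h1

/-- Iteration starts at a scalar above Y and all A j. The fixed point may a priori depend on Y;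
uniqueness removes this later. -/
theorem exists_fixedPoint_ge (A : Fin n → PosInv H) (Y : PosInv H) :
    ∃ X, X = deformedMap hσ M A X ∧ (Y ≤ deformedMap hσ M A Y → Y ≤ X) := by
  have hscalar : ∃ (r : ℝ) (hr : 0 < r), Y ≤ PosInv.scalar H r hr ∧
      ∀ j, A j ≤ PosInv.scalar H r hr := by
    obtain ⟨-, C, -, -, hCY⟩ := Y.exists_bounds
    choose _ D _ _ hDA using fun j => (A j).exists_bounds
    obtain ⟨r, hr, hr1, hr2⟩ := ((eventually_gt_atTop (0 : ℝ)).and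
      ((eventually_ge_atTop C).and (eventually_all.2 fun j => eventually_ge_atTop (D j)))).exists
    exact ⟨r, hr, hCY.trans (algebraMap_mono _ hr1), fun j => (hDA j).trans (algebraMap_mono _ (hr2 j))⟩
  obtain ⟨r, hr, hrY, hrA⟩ := hscalar
  obtain ⟨X, hX, -, h⟩ := exists_fixedPoint_le hσ hM (A := A) (Y := PosInv.scalar H r hr)
    ((deformedMap_mono hσ hM hrA le_rfl).trans_eq (deformedMap_scalar hσ hM hr))
  exact ⟨X, hX, fun hY => h Y hY hrY⟩

theorem fixedPoint_le_fixedPoint (hf : StrictMonoOn (repFun σ) (Set.Ioi 0)) {A : Fin n → PosInv H}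
    {X Y : PosInv H} (hX : X = deformedMap hσ M A X) (hY : Y = deformedMap hσ M A Y) : X ≤ Y := by
  -- The infimum of this closed set is attained; the constraint 1 ≤ l reduces the claim to excluding
  -- l > 1.
  set S : Set ℝ := {l | 1 ≤ l ∧ X.1 ≤ l • Y.1} with hS
  have hcont : Continuous fun l : ℝ => l • Y.1 := continuous_id.smul continuous_const
  have hclosed : IsClosed S :=
    (isClosed_le continuous_const continuous_id).inter (isClosed_le continuous_const hcont)
  have hne : S.Nonempty := by
    obtain ⟨c, -, hc, hcY, -⟩ := Y.exists_bounds
    obtain ⟨-, C, -, -, hCX⟩ := X.exists_bounds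
    refine ⟨max 1 (C / c), le_max_left _ _, ?_⟩
    calc X.1 ≤ algebraMap ℝ (H →L[ℂ] H) C := hCX
      _ = (C / c) • algebraMap ℝ (H →L[ℂ] H) c := by
        rw [Algebra.smul_def, ← map_mul, div_mul_cancel₀ _ hc.ne']
      _ ≤ max 1 (C / c) • algebraMap ℝ (H →L[ℂ] H) c :=
        smul_le_smul_of_nonneg_right (le_max_right _ _) (algebraMap_nonneg _ hc.le)
      _ ≤ max 1 (C / c) • Y.1 := smul_le_smul_of_nonneg_left hcY (by positivity)
  have hbdd : BddBelow S := ⟨1, fun l hl => hl.1⟩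
  obtain ⟨hl1, hlX⟩ := hclosed.csInf_mem hne hbdd
  set l := sInf S with hl
  rcases hl1.eq_or_lt with h1 | h1
  · rw [← h1, one_smul] at hlX
    exact hlX
  exfalso
  have hl0 : 0 < l := one_pos.trans h1
  have hρ : ∃ ρ : ℝ, 0 < ρ ∧ ρ < 1 ∧ ∀ j, opMean σ Y.1 (algebraMap ℝ (H →L[ℂ] H) l⁻¹ * (A j).1) ≤
      algebraMap ℝ (H →L[ℂ] H) ρ * opMean σ Y.1 (A j).1 := by
    -- Each index j gives its own factor below 1, and any larger one also works; a ρ close enough to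
    -- 1 serves all finitely many j.
    have h2 : ∀ᶠ ρ in 𝓝[<] (1 : ℝ), ∀ j, opMean σ Y.1 (algebraMap ℝ (H →L[ℂ] H) l⁻¹ * (A j).1) ≤
        algebraMap ℝ (H →L[ℂ] H) ρ * opMean σ Y.1 (A j).1 := by
      refine eventually_all.2 fun j => ?_
      obtain ⟨c, C, hc, hcY, hYC⟩ := Y.exists_bounds
      obtain ⟨d, D, hd, hdA, hAD⟩ := (A j).exists_bounds
      obtain ⟨ρ, -, hρ1, hρ⟩ := hσ.exists_opMean_le_mul hc hcY hYC hd hdA hAD hf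
        (inv_pos.2 hl0) (inv_lt_one_of_one_lt₀ h1)
      filter_upwards [Ioo_mem_nhdsLT hρ1] with r hr
      refine hρ.trans ?_
      rw [← Algebra.smul_def, ← Algebra.smul_def]
      exact smul_le_smul_of_nonneg_right hr.1.le (opMean_nonneg _ _ _)
    obtain ⟨ρ, hρ0, hρ⟩ := (h2.and (Ioo_mem_nhdsLT (one_pos (α := ℝ)))).exists
    exact ⟨ρ, hρ.1, hρ.2, hρ0⟩
  obtain ⟨ρ, hρ0, hρ1, hρ⟩ := hρ
  have hlρ : 0 < l * ρ := mul_pos hl0 hρ0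
  have h3 : X ≤ PosInv.congr (PosInv.sqrtUnit H (l * ρ) hlρ) Y := by
    rw [hX, hY, deformedMap, deformedMap, hM.congruence]
    refine hM.monotone _ _ fun j => ?_
    change (hσ.onPosInv X (A j)).1 ≤ (PosInv.congr _ _).1
    rw [PosInv.congr_sqrtUnit_val, hσ.onPosInv_val, hσ.onPosInv_val]
    have h4 : (A j).1 = algebraMap ℝ (H →L[ℂ] H) l * (algebraMap ℝ (H →L[ℂ] H) l⁻¹ * (A j).1) := by
      rw [← mul_assoc, ← map_mul, mul_inv_cancel₀ hl0.ne', map_one, one_mul]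
    have h5 : 0 ≤ algebraMap ℝ (H →L[ℂ] H) l⁻¹ * (A j).1 := by
      rw [← Algebra.smul_def]
      exact smul_nonneg (inv_pos.2 hl0).le (A j).2.1
    rw [Algebra.smul_def] at hlX
    calc opMean σ X.1 (A j).1
        ≤ opMean σ (algebraMap ℝ (H →L[ℂ] H) l * Y.1)
          (algebraMap ℝ (H →L[ℂ] H) l * (algebraMap ℝ (H →L[ℂ] H) l⁻¹ * (A j).1)) :=
        hσ.opMean_mono X.2.1 (A j).2.1 hlX h4.le
      _ = l • opMean σ Y.1 (algebraMap ℝ (H →L[ℂ] H) l⁻¹ * (A j).1) := by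
        rw [hσ.opMean_algebraMap_mul hl0 Y.2.1 h5, Algebra.smul_def]
      _ ≤ l • (algebraMap ℝ (H →L[ℂ] H) ρ * opMean σ Y.1 (A j).1) :=
        smul_le_smul_of_nonneg_left (hρ j) hl0.le
      _ = algebraMap ℝ (H →L[ℂ] H) (l * ρ) * opMean σ Y.1 (A j).1 := by
        rw [Algebra.smul_def, ← mul_assoc, ← map_mul]
  have h6 : X.1 ≤ (l * ρ) • Y.1 := by
    rw [Algebra.smul_def, ← PosInv.congr_sqrtUnit_val Y hlρ]
    exact h3
  have h7 : max 1 (l * ρ) ∈ S :=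
    ⟨le_max_left _ _, h6.trans (smul_le_smul_of_nonneg_right (le_max_right _ _) Y.2.1)⟩
  have h8 : l ≤ max 1 (l * ρ) := csInf_le hbdd h7
  have h9 : max 1 (l * ρ) < l := max_lt h1 (by nlinarith)
  linarith

end Nontrivial

end FixedPoint

/-! ### The deformed mean -/

theorem theorem2p1 {H : Type*} [NormedAddCommGroup H] [InnerProductSpace ℂ H] [CompleteSpace H]
    (hH : ¬ FiniteDimensional ℂ H) {n : ℕ}
    (M : (Fin n → PosInv H) → PosInv H) (hM : IsMultivariateMean M)
    (σ : PosOp H → PosOp H → PosOp H) (hσ : IsOperatorMean σ) (hσl : σ ≠ fun A _ => A) :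
    (∀ A : Fin n → PosInv H, ∃! X : PosInv H, X = M (fun j => hσ.onPosInv X (A j))) ∧
    ∃ Mσ : (Fin n → PosInv H) → PosInv H,
      (∀ A : Fin n → PosInv H, Mσ A = M (fun j => hσ.onPosInv (Mσ A) (A j))) ∧
      IsMultivariateMean Mσ ∧
      (∀ (A : Fin n → PosInv H) (Y : PosInv H),
        Y ≤ M (fun j => hσ.onPosInv Y (A j)) → Y ≤ Mσ A) ∧
      (∀ (A : Fin n → PosInv H) (Y : PosInv H),
        M (fun j => hσ.onPosInv Y (A j)) ≤ Y → Mσ A ≤ Y) := by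
  have := nontrivial_of_not_finiteDimensional hH
  have hf := hσ.strictMonoOn_repFun hH hσl
  have huniq : ∀ {A : Fin n → PosInv H} {X Y : PosInv H}, X = deformedMap hσ M A X →
      Y = deformedMap hσ M A Y → X = Y := fun hX hY =>
    le_antisymm (fixedPoint_le_fixedPoint hσ hM hf hX hY) (fixedPoint_le_fixedPoint hσ hM hf hY hX)
  choose Mσ hfix using fun A : Fin n → PosInv H =>
    (exists_fixedPoint_ge hσ hM A (PosInv.id H)).imp fun _ h => h.1
  have hge : ∀ A Y, Y ≤ deformedMap hσ M A Y → Y ≤ Mσ A := fun A Y hY => by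
    obtain ⟨X, hX, h⟩ := exists_fixedPoint_ge hσ hM A Y
    rw [huniq (hfix A) hX]
    exact h hY
  have hle : ∀ A Y, deformedMap hσ M A Y ≤ Y → Mσ A ≤ Y := fun A Y hY => by
    obtain ⟨X, hX, h, -⟩ := exists_fixedPoint_le hσ hM hY
    rw [huniq (hfix A) hX]
    exact h
  -- For A ≤ B, Mσ A is a subsolution of the equation for B.
  have hmono : ∀ A B : Fin n → PosInv H, (∀ j, A j ≤ B j) → Mσ A ≤ Mσ B := fun A B hAB =>
    hge B _ ((hfix A).le.trans (deformedMap_mono hσ hM hAB le_rfl))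
  refine ⟨fun A => ⟨Mσ A, hfix A, fun Y hY => huniq hY (hfix A)⟩, Mσ, hfix,
    ⟨hmono, fun A S => ?_, fun A L hA hL => ?_, ?_⟩, hge, hle⟩
  · refine huniq ?_ (hfix _)
    rw [deformedMap_congr hσ hM, ← hfix]
  · set X : ℕ → PosInv H := fun k => Mσ fun j => A j k with hX
    have hboth : ((∀ j, Antitone (A j)) ∧ Antitone X) ∨ ((∀ j, Monotone (A j)) ∧ Monotone X) :=
      hA.imp (fun h => ⟨h, fun _ _ hkm => hmono _ _ fun j => h j hkm⟩)
        fun h => ⟨h, fun _ _ hkm => hmono _ _ fun j => h j hkm⟩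
    have hlim : ∃ T : PosInv H, SOTTendsto (fun k => (X k).1) T.1 := by
      rcases hboth with ⟨h1, h2⟩ | ⟨h1, h2⟩
      · exact PosInv.exists_sotTendsto (P := Mσ L) (Or.inl h2)
          (fun k => hmono _ _ fun j => (hL j).le_of_antitone (fun _ _ h => h1 j h) k)
          fun k => h2 (Nat.zero_le k)
      · exact PosInv.exists_sotTendsto (Q := Mσ L) (Or.inr h2) (fun k => h2 (Nat.zero_le k))
          fun k => hmono _ _ fun j => (hL j).ge_of_monotone (fun _ _ h => h1 j h) k
    obtain ⟨T, hT⟩ := hlim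
    -- The strong limit T of the solutions solves the limiting equation, so uniqueness identifies it
    -- with Mσ L.
    have h1 := sotTendsto_deformedMap hσ hM hboth hL hT
    have h2 : T = deformedMap hσ M L T := by
      refine Subtype.ext (hT.unique ?_)
      refine fun x => (h1 x).congr fun k => ?_
      dsimp only
      rw [← hfix]
    rw [huniq (hfix L) h2]
    exact hT
  · refine huniq (hfix _) ?_
    simp only [deformedMap, hσ.onPosInv_id, hM.normalized]
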